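/- **Notation.** Let $\mathbb T$ be the circle group of complex numbers of modulus $1$, $X=\mathbb R\times\mathbb T$ (written additively), and $\mathbb Z(2)=\{0,1\}$ the group of residues modulo $2$. The character groups are identified as usual: for $X$ with $\mathbb R\times\mathbb Z$ via $((t,z),(s,n))=e^{its}z^n$; for $\mathbb R\times\mathbb Z(2)$ with itself via $((t,k),(s,l))=e^{its}(-1)^{kl}$; and for $\mathbb R$ with itself via $(t,s)=e^{its}$. For a probability distribution $\mu$ on one of these groups, $\hat\mu(y)=\int (x,y)\,d\mu(x)$ is its characteristic function. A probability distribution $\gamma$ is *Gaussian* if $\hat\gamma(y)=(x,y)e^{-\varphi(y)}$ for some element $x$ of the group and some continuous $\varphi\ge 0$ on the character group with $\varphi(u+v)+\varphi(u-v)=2(\varphi(u)+\varphi(v))$ for all $u,v$ (degenerate distributions are included). $E_x$ is the unit mass at $x$, and $*$ is convolution. ${\rm M}^1(S)$ is the set of probability distributions on $X$ concentrated on $S\subset X$. *Class $\Lambda$*: the probability distributions $M$ on $\mathbb R\times\mathbb Z(2)$ whose projection $E\mapsto M(E\times\mathbb Z(2))$ to $\mathbb R$ is Gaussian. *Class $\Theta$*: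 the probability distributions $M$ on $\mathbb R\times\mathbb Z(2)$ such that, for some real $\sigma,\sigma'\ge0$, $\beta,\beta',\kappa$ and all $s\in\mathbb R$, $$\hat M(s,0)=e^{-\sigma s^2+i\beta s},\qquad \hat M(s,1)=\kappa e^{-\sigma' s^2+i\beta' s},$$ where either $0<\sigma'<\sigma$ and $0<|\kappa|\le\sqrt{\sigma'/\sigma}\,\exp\{-\frac{(\beta-\beta')^2}{4(\sigma-\sigma')}\}$, or $\sigma=\sigma'$, $\beta=\beta'$ and $|\kappa|\le1$. Let $a,b\in\mathbb R$ be such that $\alpha(t,z)=(at,e^{ibt}z)$ defines a topological automorphism $\alpha=\begin{pmatrix}a&b\\0&1\end{pmatrix}$ of $X$ (equivalently, $a\neq0$). Let $G=\{(0,1),(0,-1)\}$ be the subgroup of $X$ generated by the element of order $2$, and $m_G$ its Haar distribution. For $a\ne1$ put $\tau(t,k)=\bigl(t,(-1)^k e^{ibt/(a-1)}\bigr)$ for $(t,k)\in\mathbb R\times\mathbb Z(2)$, and $F=\tau(\mathbb R\times\{0\})$; write $\tau(M)$ for the image of a distribution $M$ under $\tau$, $\Gamma(F)$ for the set of Gaussian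 distributions on $X$ concentrated on $F$, and $F+G$ for the (direct) sum of the subgroups $F$ and $G$. **Theorem 3.1.** Let $\xi_1,\xi_2$ be independent random variables with values in $X$ and distributions $\mu_1,\mu_2$. Assume that the conditional distribution of $L_2=\xi_1+\alpha\xi_2$ given $L_1=\xi_1+\xi_2$ is symmetric, i.e. for almost every value of $L_1$ it is invariant under $x\mapsto -x$. 1. If $a<0$ and $a\ne-1$, then (1a) or (1b) holds. (1a) There are $x_1,x_2\in X$ and $M_1,M_2\in\Lambda$ with $\mu_j=\tau(M_j)*E_{x_j}$ for $j=1,2$, and, for at least one $j$, $\mu_j=\gamma_j*m_G*E_{x_j}$ with some $\gamma_j\in\Gamma(F)$ and the same $x_j$. (1b) There are $x_1,x_2\in X$ and $M_1,M_2\in\Theta$ with $\mu_j=\tau(M_j)*E_{x_j}$ for $j=1,2$, and the characteristic functions $\hat\mu_1,\hat\mu_2$ vanish nowhere. 2. If $a=-1$, then there are $x_1,x_2\in X$ and $\lambda_1,\lambda_2\in{\rm M}^1(F+G)$ with $\mu_j=\lambda_j*E_{x_j}$ for $j=1,2$, and either $\lambda_2=\lambda_1*\omega_1$ for some $\omega_1\in{\rm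 M}^1(G)$ or $\lambda_1=\lambda_2*\omega_2$ for some $\omega_2\in{\rm M}^1(G)$. 3. If $a>0$, then there are $x_1,x_2\in X$ such that $\mu_1*E_{x_1}$ and $\mu_2*E_{x_2}$ are supported in $G$. -/

import Mathlib

open MeasureTheory ProbabilityTheory
open scoped Pointwise

noncomputable section

namespace HeydeRT

/-- The circle group `𝕋` of complex numbers of modulus one (with its usual topology), its
multiplication written additively so that convolution of measures is `∗`. -/
abbrev Torus : Type := Additive Circle

instance : MeasurableSpace Torus := borel Torus

instance : BorelSpace Torus := ⟨rfl⟩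

/-- The group `X = ℝ × 𝕋`. -/
abbrev RT : Type := ℝ × Torus

/-- The group `ℝ × ℤ(2)`. -/
abbrev RZ2 : Type := ℝ × ZMod 2

/-- The characters of `ℝ`: `(t, s) = e^{its}`. -/
def pairR (t s : ℝ) : ℂ := Complex.exp (Complex.I * t * s)

/-- The characters of `ℝ × ℤ(2)`, with character group `ℝ × ℤ(2)`:
`((t, k), (s, l)) = e^{its} (-1)^{kl}`. -/
def pairRZ2 (x y : RZ2) : ℂ := pairR x.1 y.1 * (-1) ^ (x.2 * y.2).val

/-- The characters of `ℝ × 𝕋`, with character group `ℝ × ℤ`: `((t, z), (s, n)) = e^{its} z^n`. -/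
def pairRT (x : RT) (y : ℝ × ℤ) : ℂ := pairR x.1 y.1 * (x.2.toMul : ℂ) ^ y.2

/-- The characteristic function of a measure on a group whose characters are given by `pair`. -/
def charFn {X Y : Type*} [MeasurableSpace X] (pair : X → Y → ℂ) (μ : Measure X) (y : Y) : ℂ :=
  ∫ x, pair x y ∂μ

/-- Gaussian distributions (possibly degenerate) on a group whose character group `Y` acts
through `pair`. -/
def IsGaussianDist {X Y : Type*} [MeasurableSpace X] [AddCommGroup Y] [TopologicalSpace Y]
    (pair : X → Y → ℂ) (γ : Measure X) : Prop :=
  IsProbabilityMeasure γ ∧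
    ∃ (x : X) (φ : Y → ℝ), Continuous φ ∧ (∀ y, 0 ≤ φ y) ∧
      (∀ u v, φ (u + v) + φ (u - v) = 2 * (φ u + φ v)) ∧
      ∀ y, charFn pair γ y = pair x y * Complex.exp (-(φ y : ℂ))

/-- `μ ∈ M¹(S)`: `μ` is a probability distribution concentrated on `S`. -/
def ConcentratedOn {X : Type*} [MeasurableSpace X] (μ : Measure X) (S : Set X) : Prop :=
  IsProbabilityMeasure μ ∧ μ Sᶜ = 0

/-- The class `Λ` of distributions on `ℝ × ℤ(2)` with Gaussian projection to `ℝ`. -/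
def ClassLambda (M : Measure RZ2) : Prop :=
  IsProbabilityMeasure M ∧ IsGaussianDist pairR (M.map Prod.fst)

/-- The class `Θ` of distributions on `ℝ × ℤ(2)`. -/
def ClassTheta (M : Measure RZ2) : Prop :=
  IsProbabilityMeasure M ∧
    ∃ σ σ' β β' κ : ℝ, 0 ≤ σ ∧ 0 ≤ σ' ∧
      ((0 < σ' ∧ σ' < σ ∧ 0 < |κ| ∧
          |κ| ≤ Real.sqrt (σ' / σ) * Real.exp (-((β - β') ^ 2 / (4 * (σ - σ'))))) ∨
        (σ = σ' ∧ β = β' ∧ |κ| ≤ 1)) ∧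
      ∀ s : ℝ,
        charFn pairRZ2 M (s, 0) = Complex.exp (-(σ : ℂ) * s ^ 2 + Complex.I * β * s) ∧
        charFn pairRZ2 M (s, 1) = κ * Complex.exp (-(σ' : ℂ) * s ^ 2 + Complex.I * β' * s)

/-- The map of `ℝ × 𝕋` with matrix `(a b; 0 1)`: `(t, z) ↦ (a t, e^{ibt} z)`. -/
def matMap (a b : ℝ) (x : RT) : RT :=
  (a * x.1, Additive.ofMul (Circle.exp (b * x.1) * x.2.toMul))

/-- `τ (t, k) = (t, (-1)^k e^{ibt/(a-1)})`; used only for `a ≠ 1`. -/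
def tau (a b : ℝ) (p : RZ2) : RT :=
  (p.1, Additive.ofMul ((-1) ^ p.2.val * Circle.exp (b * p.1 / (a - 1))))

/-- The element `(0, -1)` of order 2 of `ℝ × 𝕋`. -/
def elemTwo : RT := (0, Additive.ofMul (-1))

/-- The subgroup `G` generated by the element of order 2. -/
def subG : AddSubgroup RT := AddSubgroup.zmultiples elemTwo

/-- `F = τ(ℝ)`. -/
def subF (a b : ℝ) : Set RT := Set.range fun t : ℝ => tau a b (t, 0)

/-- The Haar distribution `m_G` of the two-element group `G`. -/
def haarG : Measure RT :=
  (2⁻¹ : ENNReal) • (Measure.dirac 0 + Measure.dirac elemTwo)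

/-- `γ ∈ Γ(F)`: a Gaussian distribution concentrated on `F`. -/
def IsGaussianOnF (a b : ℝ) (γ : Measure RT) : Prop :=
  IsGaussianDist pairRT γ ∧ ConcentratedOn γ (subF a b)

/-- The conditional distribution of `L₂` given `L₁` is symmetric: for almost every value of `L₁`
it is invariant under `x ↦ -x`. -/
def CondSymmetric {Ω X : Type*} [MeasurableSpace Ω] (P : Measure Ω) [IsFiniteMeasure P]
    [AddCommGroup X] [MeasurableSpace X] [StandardBorelSpace X]
    (L₂ L₁ : Ω → X) : Prop :=
  ∀ᵐ x ∂(P.map L₁),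
    (condDistrib L₂ L₁ P x).map (fun y => -y) = condDistrib L₂ L₁ P x

end HeydeRT

end

/-!
Write `f = μ̂₁`, `g = μ̂₂` on the character group `ℝ × ℤ`. Symmetry of the conditional distribution
says that `(L₁, L₂)` and `(L₁, -L₂)` have the same law, which by independence is Heyde's equation
`f(y + y') g(y + α̃ y') = f(y - y') g(y - α̃ y')` with `α̃ (s, n) = (a s + b n, n)`
(`heyde_functional_equation`).

For `a ≠ 1` put `c = b / (a - 1)`. The vector `(-c, 1)` is fixed by `α̃`, so the equation at `y = y'
= (-c, 1)` gives `f(-2c, 2) g(-2c, 2) = 1`, and both factors have modulus one. Hence `(e^{-ict} w)²`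
is almost surely constant under `μ₁` and under `μ₂`: up to a translation the distributions are
`τ(M₁)`, `τ(M₂)` with `M₁, M₂` on `ℝ × ℤ(2)`, and the two components `M̂ⱼ(·, k)`, `k = 0, 1`,
satisfy Heyde's equation on the line with the same `a` (`HeydeEq.exists_eq_map_tauHom`).

On the line, for `a ≠ 0, ±1`, a solution with `f(0), g(0) ≠ 0` has no zeros (`heyde_ne_zero`, a
minimal-zero argument); its continuous logarithms are quadratic because a mixed second difference is
constant (`exists_quadratic`); so it is a constant times a Gaussian characteristic function
(`heyde_gaussian_form`).

* `a > 0`: the even components have variances with `σ₁ + a σ₂ = 0`, hence are degenerate, and the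
  distributions sit on a coset of `G`. For `a = 1` the same follows directly from the equation with
  `y = y'`.
* `a = -1`: the equation says that the even components agree and the odd ones are proportional, with
  a real coefficient; one of `M₁, M₂` is then the other convolved with a two-point distribution.
* `a < 0`, `a ≠ -1`: the even components are Gaussian. Both slices of `Mⱼ` are dominated by a
  Gaussian, so the odd components are real-analytic. If one of them vanishes identically, that `Mⱼ`
  is a Gaussian convolved with the Haar distribution. Otherwise neither vanishes at `0`, both are
  multiples of Gaussian characteristic functions, and positivity of the slices gives the inequality
  in the class `Θ` (`classTheta_of_charFn`, which rests on the comparison `smul_gaussianReal_le`).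
-/

namespace HeydeRT

/-! ### Heyde's equation on the line -/

/-- The zero of smallest absolute value of a continuous function with symmetric zero set. -/
theorem exists_min_zero {f : ℝ → ℂ} (hf : Continuous f) (h0 : f 0 ≠ 0)
    (heven : ∀ x, f x = 0 → f (-x) = 0) (hz : ∃ x, f x = 0) :
    ∃ r, 0 < r ∧ f r = 0 ∧ ∀ v, |v| < r → f v ≠ 0 := by
  set S : Set ℝ := {x | 0 ≤ x ∧ f x = 0}
  have hS : IsClosed S := (isClosed_le continuous_const continuous_id).inter
    (isClosed_eq hf continuous_const)
  have habs : ∀ x, f x = 0 → |x| ∈ S := fun x hx =>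
    ⟨abs_nonneg x, by rcases abs_choice x with h | h <;> rw [h]; exacts [hx, heven x hx]⟩
  have hne : S.Nonempty := by
    obtain ⟨x, hx⟩ := hz
    exact ⟨_, habs x hx⟩
  have hb : BddBelow S := ⟨0, fun x hx => hx.1⟩
  have hmem := hS.csInf_mem hne hb
  refine ⟨sInf S, lt_of_le_of_ne hmem.1 ?_, hmem.2, fun v hv hfv => ?_⟩
  · intro h
    exact h0 (h ▸ hmem.2)
  · exact absurd (csInf_le hb (habs v hfv)) (not_le.2 hv)

theorem eq_zero_of_abs_le {k : ℝ → ℂ} (hk : Continuous k) {r : ℝ} (hr : 0 < r)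
    (h : ∀ v, |v| < r → k v = 0) (v : ℝ) (hv : |v| ≤ r) : k v = 0 := by
  have hc : IsClosed {v | k v = 0} := isClosed_eq hk continuous_const
  have hsub : Metric.ball (0 : ℝ) r ⊆ {v | k v = 0} := fun v hv => h v (by simpa using hv)
  have := hc.closure_subset_iff.2 hsub
  rw [closure_ball (0 : ℝ) hr.ne'] at this
  exact this (by simpa using hv)

/-- Solutions of Heyde's functional equation have no zeros. If `r`, `s` are the smallest absolute
values of zeros of `f` and `g`, the equation turns a zero of either function into a whole interval
of zeros of `g`; comparing the ends of these intervals with `s` is contradictory. Positive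
definiteness is not needed, so the result also applies to the odd components, which are not
characteristic functions. -/
theorem heyde_ne_zero {a : ℝ} (ha0 : a ≠ 0) (ha1 : a ≠ -1) {f g : ℝ → ℂ}
    (hf : Continuous f) (hg : Continuous g) (hf0 : f 0 ≠ 0) (hg0 : g 0 ≠ 0)
    (hfe : ∀ x, f x = 0 → f (-x) = 0) (hge : ∀ x, g x = 0 → g (-x) = 0)
    (H : ∀ u v, f (u + v) * g (u + a * v) = f (u - v) * g (u - a * v)) :
    (∀ x, f x ≠ 0) ∧ ∀ x, g x ≠ 0 := by
  have ha1' : 1 + a ≠ 0 := fun h => ha1 (by linarith)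
  -- Arguments making the two sides `f x * g _` and `f v * g w`, with `w` the stated point.
  have HA : ∀ x v, f x = 0 → f v ≠ 0 → g (((1 - a) * x + (1 + a) * v) / 2) = 0 := by
    intro x v hx hv
    have := H ((x + v) / 2) ((x - v) / 2)
    rw [show (x + v) / 2 + (x - v) / 2 = x by ring, show (x + v) / 2 - (x - v) / 2 = v by ring,
      hx, zero_mul, eq_comm, mul_eq_zero] at this
    rw [← this.resolve_left hv]
    congr 1
    ring
  -- Arguments making the two sides `f _ * g x` and `f v * g w`, with `w` the stated point.
  have HB : ∀ x v, g x = 0 → f v ≠ 0 → g (((1 - a) * x + 2 * a * v) / (1 + a)) = 0 := by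
    intro x v hx hv
    have := H (v + (x - v) / (1 + a)) ((x - v) / (1 + a))
    rw [show v + (x - v) / (1 + a) + a * ((x - v) / (1 + a)) = x by field_simp; ring,
      show v + (x - v) / (1 + a) - (x - v) / (1 + a) = v by ring,
      hx, mul_zero, eq_comm, mul_eq_zero] at this
    rw [← this.resolve_left hv]
    congr 1
    field_simp
    ring
  have hfg : (∃ x, f x = 0) → ∃ x, g x = 0 := fun ⟨x, hx⟩ => ⟨_, HA x 0 hx hf0⟩
  have hgf : (∃ x, g x = 0) → ∃ x, f x = 0 := by
    rintro ⟨x, hx⟩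
    by_contra! hne
    have := HB x (-(1 - a) * x / (2 * a)) hx (hne _)
    rw [show (1 - a) * x + 2 * a * (-(1 - a) * x / (2 * a)) = 0 by field_simp; ring,
      zero_div] at this
    exact hg0 this
  suffices hno : ¬ ∃ x, f x = 0 by
    exact ⟨fun x hx => hno ⟨x, hx⟩, fun x hx => hno (hgf ⟨x, hx⟩)⟩
  intro hfz
  obtain ⟨r, hr, hfr, hfr'⟩ := exists_min_zero hf hf0 hfe hfz
  obtain ⟨s, hs, hgs, hgs'⟩ := exists_min_zero hg hg0 hge (hfg hfz)
  have HA' : ∀ v, |v| ≤ r → g (((1 - a) * r + (1 + a) * v) / 2) = 0 :=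
    eq_zero_of_abs_le (by fun_prop) hr fun v hv => HA r v hfr (hfr' v hv)
  have HB' : ∀ v, |v| ≤ r → g (((1 - a) * s + 2 * a * v) / (1 + a)) = 0 :=
    eq_zero_of_abs_le (by fun_prop) hr fun v hv => HB s v hgs (hfr' v hv)
  have hle : ∀ x, g x = 0 → s ≤ |x| := fun x hx => not_lt.1 fun h => hgs' x h hx
  rcases lt_or_gt_of_ne ha0 with ha | ha
  · have h1 : s ≤ r := by
      have := hle _ (HA' r (abs_of_pos hr).le)
      rwa [show ((1 - a) * r + (1 + a) * r) / 2 = r by ring, abs_of_pos hr] at this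
    have h2 : s ≤ -a * r := by
      have := hle _ (HA' (-r) (by rw [abs_neg, abs_of_pos hr]))
      rwa [show ((1 - a) * r + (1 + a) * (-r)) / 2 = -a * r by ring,
        abs_of_pos (by nlinarith)] at this
    have h3 : 0 < (1 - a) * s + 2 * a * r := by
      by_contra! hcon
      have hv0 : 0 ≤ -(1 - a) * s / (2 * a) :=
        div_nonneg_of_nonpos (by nlinarith) (by linarith)
      have hv : |-(1 - a) * s / (2 * a)| ≤ r := by
        rw [abs_of_nonneg hv0, div_le_iff_of_neg (by linarith)]
        linarith
      have := HB' _ hv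
      rw [show (1 - a) * s + 2 * a * (-(1 - a) * s / (2 * a)) = 0 by field_simp; ring,
        zero_div] at this
      exact hg0 this
    have h4 := hle _ (HB' r (abs_of_pos hr).le)
    rw [abs_div, abs_of_pos h3, le_div_iff₀ (abs_pos.2 ha1')] at h4
    rcases lt_or_gt_of_ne ha1' with h | h
    · rw [abs_of_neg h] at h4
      nlinarith
    · rw [abs_of_pos h] at h4
      nlinarith
  · have hv : |-(1 - a) * r / (1 + a)| ≤ r := by
      have h1 : (0 : ℝ) < 1 + a := by linarith
      rw [abs_div, abs_of_pos h1, div_le_iff₀ h1, abs_le]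
      constructor <;> nlinarith
    have := HA' _ hv
    rw [show (1 - a) * r + (1 + a) * (-(1 - a) * r / (1 + a)) = 0 by field_simp; ring,
      zero_div] at this
    exact hg0 this

theorem exists_eq_mul_of_additive {A : ℝ → ℂ} (hA : Continuous A)
    (hadd : ∀ x y, A (x + y) = A x + A y) (x : ℝ) : A x = x * A 1 := by
  have := map_real_smul (AddMonoidHom.mk' A hadd) hA x 1
  simpa using this

/-- Continuous solutions of the additive form of Heyde's equation are quadratic polynomials. In the
variables `x = u + v`, `y = u - v` it reads `φ x + ψ (p x + q y) = φ y + ψ (q x + p y)`, and a mixed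
second difference in `x` and `y` eliminates `φ`. -/
theorem exists_quadratic {a : ℝ} (ha0 : a ≠ 0) (ha1 : a ≠ 1) (ha1' : a ≠ -1) {φ ψ : ℝ → ℂ}
    (hψ : Continuous ψ)
    (H : ∀ u v, φ (u + v) + ψ (u + a * v) = φ (u - v) + ψ (u - a * v)) :
    (∃ B C : ℂ, ∀ x, φ x = φ 0 + B * x + C * x ^ 2) ∧
      ∃ B C : ℂ, ∀ x, ψ x = ψ 0 + B * x + C * x ^ 2 := by
  obtain ⟨p, hp⟩ : ∃ p, p = (1 + a) / 2 := ⟨_, rfl⟩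
  obtain ⟨q, hq⟩ : ∃ q, q = (1 - a) / 2 := ⟨_, rfl⟩
  have hp0 : p ≠ 0 := fun h => ha1' (by linarith)
  have hq0 : q ≠ 0 := fun h => ha1 (by linarith)
  have H' : ∀ x y, φ x + ψ (p * x + q * y) = φ y + ψ (q * x + p * y) := by
    intro x y
    have := H ((x + y) / 2) ((x - y) / 2)
    convert this using 3 <;> first | (rw [hp, hq]; ring) | ring1
  have hdet : p ^ 2 - q ^ 2 = a := by rw [hp, hq]; ring
  -- The mixed second difference of `ψ` does not depend on the base point: as `p ^ 2 - q ^ 2 ≠ 0`,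
  -- the points `p x + q y` and `q x + p y` can be prescribed independently, here as `z` and `0`.
  have hD : ∀ z h k, ψ (z + h + k) - ψ (z + h) - ψ (z + k) + ψ z
      = ψ (h + k) - ψ h - ψ k + ψ 0 := by
    have key : ∀ z h k, ψ (z + h + k) - ψ (z + h) - ψ (z + k) + ψ z
        = ψ (q * (h / p) + p * (k / q)) - ψ (q * (h / p)) - ψ (p * (k / q)) + ψ 0 := by
      intro z h k
      have e1 : p * (p * z / a) + q * (-q * z / a) = z := by
        field_simp; linear_combination z * hdet
      have e2 : q * (p * z / a) + p * (-q * z / a) = 0 := by ring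
      have e3 : p * (h / p) = h := by field_simp
      have e4 : q * (k / q) = k := by field_simp
      have A1 := H' (p * z / a) (-q * z / a)
      have A2 := H' (p * z / a + h / p) (-q * z / a)
      have A3 := H' (p * z / a) (-q * z / a + k / q)
      have A4 := H' (p * z / a + h / p) (-q * z / a + k / q)
      rw [e1, e2] at A1
      rw [show p * (p * z / a + h / p) + q * (-q * z / a) = z + h by linear_combination e1 + e3,
        show q * (p * z / a + h / p) + p * (-q * z / a) = q * (h / p) by
          linear_combination e2] at A2
      rw [show p * (p * z / a) + q * (-q * z / a + k / q) = z + k by linear_combination e1 + e4,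
        show q * (p * z / a) + p * (-q * z / a + k / q) = p * (k / q) by
          linear_combination e2] at A3
      rw [show p * (p * z / a + h / p) + q * (-q * z / a + k / q) = z + h + k by
          linear_combination e1 + e3 + e4,
        show q * (p * z / a + h / p) + p * (-q * z / a + k / q) = q * (h / p) + p * (k / q) by
          linear_combination e2] at A4
      linear_combination A4 - A2 - A3 + A1
    intro z h k
    have := key 0 h k
    rw [zero_add, zero_add] at this
    rw [key z h k, ← this]
  have hψq : ∃ B C : ℂ, ∀ x, ψ x = ψ 0 + B * x + C * x ^ 2 := by
    set c : ℝ → ℝ → ℂ := fun h k => ψ (h + k) - ψ h - ψ k + ψ 0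
    have hcadd : ∀ k x y, c (x + y) k = c x k + c y k := by
      intro k x y
      simp only [c]
      linear_combination hD x y k
    have hcomm : ∀ h k, c h k = c k h := by
      intro h k
      simp only [c, add_comm h k]
      ring
    have hc1 : ∀ h k, c h k = h * k * c 1 1 := by
      intro h k
      rw [exists_eq_mul_of_additive (A := fun h => c h k) (by fun_prop) (hcadd k) h, hcomm 1 k,
        exists_eq_mul_of_additive (A := fun h => c h 1) (by fun_prop) (hcadd 1) k]
      ring
    set A : ℝ → ℂ := fun x => ψ x - ψ 0 - c 1 1 / 2 * x ^ 2
    have hA : ∀ x, A x = x * A 1 := by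
      refine exists_eq_mul_of_additive (by fun_prop) fun x y => ?_
      have := hc1 x y
      simp only [A]
      push_cast
      simp only [c] at this ⊢
      linear_combination this
    refine ⟨A 1, c 1 1 / 2, fun x => ?_⟩
    have := hA x
    simp only [A] at this ⊢
    linear_combination this
  refine ⟨?_, hψq⟩
  obtain ⟨B, C, hBC⟩ := hψq
  refine ⟨B * (q - p), C * (q ^ 2 - p ^ 2), fun x => ?_⟩
  have h1 := H' x 0
  simp only [mul_zero, add_zero] at h1
  have h2 := hBC (p * x)
  have h3 := hBC (q * x)
  push_cast at h2 h3
  linear_combination h1 + h3 - h2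

theorem exists_continuous_log {f : ℝ → ℂ} (hf : Continuous f) (h0 : ∀ x, f x ≠ 0) :
    ∃ φ : ℝ → ℂ, Continuous φ ∧ ∀ x, f x = Complex.exp (φ x) := by
  have hU : IsSimplyConnected (Set.univ : Set ℝ) :=
    have := (convex_univ (𝕜 := ℝ) (E := ℝ)).contractibleSpace Set.univ_nonempty
    inferInstanceAs (SimplyConnectedSpace (Set.univ : Set ℝ))
  obtain ⟨φ, hφ, h⟩ := Complex.exists_continuousOn_eqOn_exp_comp hU isOpen_univ
    hf.continuousOn (by simpa using h0)
  exact ⟨φ, continuousOn_univ.1 hφ, fun x => (h (Set.mem_univ x)).symm⟩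

theorem heyde_exp_quadratic {a : ℝ} (ha0 : a ≠ 0) (ha1 : a ≠ 1) (ha1' : a ≠ -1) {f g : ℝ → ℂ}
    (hf : Continuous f) (hg : Continuous g) (hf0 : ∀ x, f x ≠ 0) (hg0 : ∀ x, g x ≠ 0)
    (H : ∀ u v, f (u + v) * g (u + a * v) = f (u - v) * g (u - a * v)) :
    (∃ B C : ℂ, ∀ x : ℝ, f x = f 0 * Complex.exp (B * x + C * x ^ 2)) ∧
      ∃ B C : ℂ, ∀ x : ℝ, g x = g 0 * Complex.exp (B * x + C * x ^ 2) := by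
  obtain ⟨φ, hφ, hfφ⟩ := exists_continuous_log hf hf0
  obtain ⟨ψ, hψ, hgψ⟩ := exists_continuous_log hg hg0
  have hH : ∀ u v, φ (u + v) + ψ (u + a * v) = φ (u - v) + ψ (u - a * v) := by
    intro u v
    -- For fixed `u` the difference is continuous in `v`, takes values in `2πiℤ`, and vanishes
    -- at `v = 0`.
    set d : ℝ → ℂ := fun v => φ (u + v) + ψ (u + a * v) - (φ (u - v) + ψ (u - a * v))
    have hd : Continuous d := by fun_prop
    have hexp : ∀ v, Complex.exp (d v) = 1 := by
      intro v
      have := H u v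
      rw [hfφ, hgψ, hfφ, hgψ, ← Complex.exp_add, ← Complex.exp_add] at this
      rw [Complex.exp_sub, this, div_self (Complex.exp_ne_zero _)]
    choose n hn using fun v => Complex.exp_eq_one_iff.1 (hexp v)
    have hnc : Continuous n := by
      have hn' : ∀ v, ((n v : ℤ) : ℝ) = (d v / (2 * Real.pi * Complex.I)).re := by
        intro v
        rw [hn v, mul_div_cancel_right₀ _ Complex.two_pi_I_ne_zero]
        simp
      have : Continuous fun v => ((n v : ℤ) : ℝ) := by
        simp only [hn']
        fun_prop
      exact Int.isClosedEmbedding_coe_real.isEmbedding.continuous_iff.2 this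
    have hconst : n v = n 0 := PreconnectedSpace.constant inferInstance hnc
    have hd0 : d 0 = 0 := by simp [d]
    have : d v = 0 := by rw [hn v, hconst, ← hn 0, hd0]
    exact sub_eq_zero.1 this
  obtain ⟨⟨B, C, h1⟩, B', C', h2⟩ := exists_quadratic ha0 ha1 ha1' hψ hH
  refine ⟨⟨B, C, fun x => ?_⟩, B', C', fun x => ?_⟩
  · rw [hfφ, hfφ, ← Complex.exp_add, h1, add_assoc]
  · rw [hgψ, hgψ, ← Complex.exp_add, h2, add_assoc]

/-- The Hermitian symmetry makes `B` imaginary and `C` real, and boundedness makes `C` nonpositive.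
-/
theorem exists_gaussian_form {f : ℝ → ℂ} (h0 : f 0 ≠ 0) (hconj : ∀ x, f (-x) = star (f x))
    (hbd : ∀ x, ‖f x‖ ≤ 1) {B C : ℂ}
    (hf : ∀ x : ℝ, f x = f 0 * Complex.exp (B * x + C * x ^ 2)) :
    ∃ σ β : ℝ, 0 ≤ σ ∧
      ∀ s : ℝ, f s = f 0 * Complex.exp (-(σ : ℂ) * s ^ 2 + Complex.I * β * s) := by
  have hpos : 0 < ‖f 0‖ := norm_pos_iff.2 h0
  have hnorm : ∀ x : ℝ, ‖f x‖ = ‖f 0‖ * Real.exp (B.re * x + C.re * x ^ 2) := by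
    intro x
    rw [hf x, norm_mul, Complex.norm_exp]
    congr 2
    simp [← Complex.ofReal_pow]
  have hB : B.re = 0 := by
    have h1 := hnorm 1
    have h2 := hnorm (-1)
    rw [hconj, norm_star, h1] at h2
    have := Real.exp_injective (mul_left_cancel₀ hpos.ne' h2)
    norm_num at this
    linarith
  have hC : C.re ≤ 0 := by
    by_contra! hC
    have h1 : ∀ t : ℝ, 0 ≤ t → ‖f 0‖ * (C.re * t + 1) ≤ 1 := by
      intro t ht
      have := hbd (Real.sqrt t)
      rw [hnorm, hB, Real.sq_sqrt ht, zero_mul, zero_add] at this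
      exact (mul_le_mul_of_nonneg_left (Real.add_one_le_exp _) hpos.le).trans this
    have := h1 (1 / (‖f 0‖ * C.re)) (by positivity)
    have e : ‖f 0‖ * (C.re * (1 / (‖f 0‖ * C.re)) + 1) = 1 + ‖f 0‖ := by field_simp
    linarith
  have hCi : C.im = 0 := by
    by_contra hCi
    have h1 : ∀ x : ℝ, Complex.exp ((2 * C.im * x ^ 2 : ℝ) * Complex.I) = 1 := by
      intro x
      have hc := hconj x
      have hc0 := hconj 0
      rw [neg_zero] at hc0
      rw [hf (-x), hf x, star_mul', ← hc0] at hc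
      have hc' := mul_left_cancel₀ h0 hc
      have e : star (Complex.exp (B * x + C * x ^ 2))
          = Complex.exp (star B * x + star C * x ^ 2) := by
        simp [← Complex.exp_conj]
      rw [e] at hc'
      have hB' : star B = -B := by
        apply Complex.ext <;> simp [hB]
      have hCC : C - star C = 2 * C.im * Complex.I := by
        apply Complex.ext
        · simp
        · simp
          ring
      have e2 : ((2 * C.im * x ^ 2 : ℝ) : ℂ) * Complex.I
          = B * ((-x : ℝ) : ℂ) + C * ((-x : ℝ) : ℂ) ^ 2 - (star B * x + star C * x ^ 2) := by
        rw [hB']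
        push_cast
        linear_combination (-(x : ℂ) ^ 2) * hCC
      rw [e2, Complex.exp_sub, hc', div_self (Complex.exp_ne_zero _)]
    have h2 := h1 (Real.sqrt (Real.pi / (2 * |C.im|)))
    rw [Real.sq_sqrt (by positivity)] at h2
    rcases abs_cases C.im with ⟨h, _⟩ | ⟨h, _⟩
    · rw [h, show 2 * C.im * (Real.pi / (2 * C.im)) = Real.pi by field_simp,
        Complex.exp_pi_mul_I] at h2
      norm_num at h2
    · rw [h, show 2 * C.im * (Real.pi / (2 * -C.im)) = -Real.pi by field_simp,
        Complex.ofReal_neg, neg_mul, Complex.exp_neg, Complex.exp_pi_mul_I] at h2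
      norm_num at h2
  refine ⟨-C.re, B.im, by linarith, fun s => ?_⟩
  rw [hf s]
  have hB' : B = Complex.I * B.im := by apply Complex.ext <;> simp [hB]
  have hC' : C = C.re := by apply Complex.ext <;> simp [hCi]
  rw [hB', hC']
  congr 2
  simp
  ring

/-- Heyde's theorem for two variables on the line, in a form that does not presuppose that `f`, `g`
are characteristic functions. -/
theorem heyde_gaussian_form {a : ℝ} (ha0 : a ≠ 0) (ha1 : a ≠ 1) (ha1' : a ≠ -1) {f g : ℝ → ℂ}
    (hf : Continuous f) (hg : Continuous g) (hf0 : f 0 ≠ 0) (hg0 : g 0 ≠ 0)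
    (hfc : ∀ x, f (-x) = star (f x)) (hgc : ∀ x, g (-x) = star (g x))
    (hfb : ∀ x, ‖f x‖ ≤ 1) (hgb : ∀ x, ‖g x‖ ≤ 1)
    (H : ∀ u v, f (u + v) * g (u + a * v) = f (u - v) * g (u - a * v)) :
    (∃ σ β : ℝ, 0 ≤ σ ∧
      ∀ s : ℝ, f s = f 0 * Complex.exp (-(σ : ℂ) * s ^ 2 + Complex.I * β * s)) ∧
    ∃ σ β : ℝ, 0 ≤ σ ∧
      ∀ s : ℝ, g s = g 0 * Complex.exp (-(σ : ℂ) * s ^ 2 + Complex.I * β * s) := by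
  obtain ⟨hf', hg'⟩ := heyde_ne_zero ha0 ha1' hf hg hf0 hg0
    (fun x hx => by rw [hfc, hx, star_zero]) (fun x hx => by rw [hgc, hx, star_zero]) H
  obtain ⟨⟨B, C, h1⟩, B', C', h2⟩ := heyde_exp_quadratic ha0 ha1 ha1' hf hg hf' hg' H
  exact ⟨exists_gaussian_form hf0 hfc hfb h1, exists_gaussian_form hg0 hgc hgb h2⟩

/-! ### Gaussian measures on the line -/

/-- Comparison of a multiple of one Gaussian density with another: the quotient of the densities is
the exponential of a quadratic polynomial, which has to be bounded above. When `v' < v`, its maximum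
is attained at `(m' v - m v') / (v - v')` and gives the bound on `c`. -/
theorem of_gaussian_density_le {m m' v v' c : ℝ} (hv : 0 < v) (hv' : 0 < v')
    (hc : 0 < c)
    (h : ∀ x, c * ((√(2 * Real.pi * v'))⁻¹ * Real.exp (-(x - m') ^ 2 / (2 * v')))
      ≤ (√(2 * Real.pi * v))⁻¹ * Real.exp (-(x - m) ^ 2 / (2 * v))) :
    (v' = v ∧ m' = m) ∨
      (v' < v ∧ c ≤ √(v' / v) * Real.exp (-((m - m') ^ 2 / (2 * (v - v'))))) := by
  have hpi := Real.pi_pos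
  have h1 : ∀ x, c ≤ √(v' / v) *
      Real.exp ((x - m') ^ 2 / (2 * v') - (x - m) ^ 2 / (2 * v)) := by
    intro x
    have hx := h x
    have e1 : Real.exp ((x - m') ^ 2 / (2 * v') - (x - m) ^ 2 / (2 * v))
        = Real.exp (-(x - m) ^ 2 / (2 * v)) / Real.exp (-(x - m') ^ 2 / (2 * v')) := by
      rw [← Real.exp_sub]
      congr 1
      ring
    have e2 : √(v' / v) = √(2 * Real.pi * v') / √(2 * Real.pi * v) := by
      rw [← Real.sqrt_div (by positivity)]
      congr 1
      field_simp
    rw [e1, e2, div_mul_div_comm, le_div_iff₀ (by positivity)]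
    have h3 : 0 < √(2 * Real.pi * v') := by positivity
    have h4 : 0 < √(2 * Real.pi * v) := by positivity
    rw [inv_mul_eq_div, inv_mul_eq_div, mul_div_assoc', div_le_div_iff₀ h3 h4] at hx
    linarith
  have h2 : ∃ K, ∀ x, K ≤ (x - m') ^ 2 / (2 * v') - (x - m) ^ 2 / (2 * v) := by
    refine ⟨Real.log (c / √(v' / v)), fun x => ?_⟩
    rw [Real.log_le_iff_le_exp (by positivity), div_le_iff₀ (by positivity), mul_comm]
    exact h1 x
  obtain ⟨K, hK⟩ := h2
  rcases lt_trichotomy v' v with hlt | heq | hgt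
  · refine Or.inr ⟨hlt, ?_⟩
    convert h1 ((m' * v - m * v') / (v - v')) using 3
    have : v - v' ≠ 0 := by linarith
    field_simp
    ring
  · refine Or.inl ⟨heq, ?_⟩
    subst heq
    by_contra hne
    have hd : m - m' ≠ 0 := sub_ne_zero.2 (Ne.symm hne)
    -- The exponent is a nonconstant affine function of `x`.
    have := hK (((K - 1) * (2 * v') / (m - m') + m + m') / 2)
    have e : ((((K - 1) * (2 * v') / (m - m') + m + m') / 2) - m') ^ 2 / (2 * v') -
        ((((K - 1) * (2 * v') / (m - m') + m + m') / 2) - m) ^ 2 / (2 * v') = K - 1 := by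
      field_simp
      ring
    linarith
  · exfalso
    obtain ⟨A, hA⟩ : ∃ A, A = 1 / (2 * v') := ⟨_, rfl⟩
    obtain ⟨B, hB⟩ : ∃ B, B = 1 / (2 * v) := ⟨_, rfl⟩
    have hAB : A < B := by
      rw [hA, hB]
      exact one_div_lt_one_div_of_lt (by positivity) (by linarith)
    have hApos : 0 < A := by rw [hA]; positivity
    have hK' : ∀ x, K ≤ (x - m') ^ 2 * A - (x - m) ^ 2 * B := by
      intro x
      have := hK x
      rw [hA, hB]
      simpa [div_eq_mul_inv] using this
    -- Averaging over `m ± t` removes the linear term.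
    have hT : ∀ t : ℝ, K ≤ A * (m - m') ^ 2 - (B - A) * t ^ 2 := by
      intro t
      have h1 := hK' (m + t)
      have h2 := hK' (m - t)
      nlinarith
    have h0 : 0 ≤ (A * (m - m') ^ 2 + |K| + 1) / (B - A) :=
      div_nonneg (by positivity) (by linarith)
    have := hT (√((A * (m - m') ^ 2 + |K| + 1) / (B - A)))
    rw [Real.sq_sqrt h0, mul_div_cancel₀ _ (by linarith : B - A ≠ 0)] at this
    have := neg_abs_le K
    linarith

/-- Domination between Gaussian measures, degenerate ones included. -/
theorem smul_gaussianReal_le {m m' c : ℝ} {v v' : NNReal} (hc : 0 < c)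
    (h : ENNReal.ofReal c • gaussianReal m' v' ≤ gaussianReal m v) :
    (v' = v ∧ m' = m ∧ c ≤ 1) ∨
      (0 < v' ∧ v' < v ∧
        c ≤ √((v' : ℝ) / v) * Real.exp (-((m - m') ^ 2 / (2 * ((v : ℝ) - v'))))) := by
  have hc1 : c ≤ 1 := by
    have := h Set.univ
    simpa using this
  have hc0 : ENNReal.ofReal c ≠ 0 := by simpa using hc
  by_cases hv : v = 0
  · left
    subst hv
    rw [gaussianReal_zero_var] at h
    have h1 := h {m}ᶜ
    simp only [Measure.smul_apply, smul_eq_mul, Measure.dirac_apply' _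
      (measurableSet_singleton m).compl, Set.mem_compl_iff, Set.mem_singleton_iff,
      not_true_eq_false,
      not_false_eq_true, Set.indicator_of_notMem, nonpos_iff_eq_zero, mul_eq_zero, hc0,
      false_or] at h1
    by_cases hv' : v' = 0
    · subst hv'
      rw [gaussianReal_zero_var, Measure.dirac_apply' _ (measurableSet_singleton m).compl] at h1
      refine ⟨rfl, ?_, hc1⟩
      by_contra hne
      simp [hne] at h1
    · have := nullSingletonClass_gaussianReal (μ := m') hv'
      have h2 := measure_add_measure_compl (μ := gaussianReal m' v') (measurableSet_singleton m)
      rw [h1, measure_singleton, measure_univ] at h2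
      simp at h2
  have hv0 : 0 < v := pos_iff_ne_zero.2 hv
  by_cases hv' : v' = 0
  · exfalso
    subst hv'
    have := nullSingletonClass_gaussianReal (μ := m) hv
    have h1 := h {m'}
    rw [measure_singleton (μ := gaussianReal m v), gaussianReal_zero_var] at h1
    simp at h1
    linarith
  have hv0' : 0 < v' := pos_iff_ne_zero.2 hv'
  have hae : ∀ᵐ x, ENNReal.ofReal c * gaussianPDF m' v' x ≤ gaussianPDF m v x := by
    refine ae_le_of_forall_setLIntegral_le_of_sigmaFinite
      ((measurable_gaussianPDF _ _).const_mul _) fun s hs _ => ?_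
    rw [lintegral_const_mul _ (measurable_gaussianPDF _ _), ← gaussianReal_apply _ hv',
      ← gaussianReal_apply _ hv]
    exact h s
  have hae' : ∀ᵐ x : ℝ, x ∈ {x : ℝ | c * gaussianPDFReal m' v' x ≤ gaussianPDFReal m v x} := by
    filter_upwards [hae] with x hx
    rw [gaussianPDF, gaussianPDF, ← ENNReal.ofReal_mul hc.le,
      ENNReal.ofReal_le_ofReal_iff (gaussianPDFReal_nonneg _ _ _)] at hx
    exact hx
  have hclosed : IsClosed {x : ℝ | c * gaussianPDFReal m' v' x ≤ gaussianPDFReal m v x} := by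
    simp only [gaussianPDFReal]
    exact isClosed_le (by fun_prop) (by fun_prop)
  have hall : ∀ x, c * gaussianPDFReal m' v' x ≤ gaussianPDFReal m v x := by
    intro x
    have := (Measure.dense_of_ae hae').closure_eq
    rw [Set.ofPred_mem_eq, hclosed.closure_eq] at this
    exact Set.eq_univ_iff_forall.1 this x
  rcases of_gaussian_density_le (by exact_mod_cast hv0) (by exact_mod_cast hv0') hc hall
    with ⟨h1, h2⟩ | ⟨h1, h2⟩
  · exact Or.inl ⟨by exact_mod_cast h1, h2, hc1⟩
  · exact Or.inr ⟨hv0', by exact_mod_cast h1, h2⟩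

/-- A measure dominated by a Gaussian has all exponential moments, so its characteristic function is
the restriction of an entire function. -/
theorem analyticOnNhd_charFun_of_le_gaussianReal {S : Measure ℝ} {m : ℝ} {v : NNReal}
    (h : S ≤ gaussianReal m v) : AnalyticOnNhd ℝ (charFun S) Set.univ := by
  have hset : integrableExpSet id S = Set.univ := by
    refine Set.eq_univ_of_forall fun t => ?_
    exact (integrable_exp_mul_gaussianReal t).mono_measure h
  intro x _
  have h1 : AnalyticAt ℂ (complexMGF id S) ((x : ℂ) * Complex.I) :=
    analyticAt_complexMGF (by simp [hset])
  have h2 : AnalyticAt ℝ (fun t : ℝ => (t : ℂ) * Complex.I) x :=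
    (Complex.ofRealCLM.analyticAt x).mul analyticAt_const
  have h3 := (h1.restrictScalars (𝕜 := ℝ)).comp_of_eq h2 rfl
  refine h3.congr (Filter.Eventually.of_forall fun t => ?_)
  exact complexMGF_id_mul_I t

/-! ### `ℝ × ℤ(2)` -/

/-- The part of `M` carried by `ℝ × {k}`, as a measure on `ℝ`. -/
noncomputable def slice (M : Measure RZ2) (k : ZMod 2) : Measure ℝ :=
  (M.restrict (Prod.snd ⁻¹' {k})).map Prod.fst

instance (M : Measure RZ2) [IsFiniteMeasure M] (k : ZMod 2) : IsFiniteMeasure (slice M k) := by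
  unfold slice
  infer_instance

theorem slice_map (M : Measure RZ2) (k : ZMod 2) :
    (slice M k).map (fun t => (t, k)) = M.restrict (Prod.snd ⁻¹' {k}) := by
  have hk : MeasurableSet (Prod.snd ⁻¹' {k} : Set RZ2) :=
    measurable_snd (measurableSet_singleton k)
  rw [slice, Measure.map_map (by fun_prop) measurable_fst]
  conv_rhs => rw [← Measure.map_id (μ := M.restrict (Prod.snd ⁻¹' {k}))]
  refine Measure.map_congr ?_
  filter_upwards [ae_restrict_mem hk] with x hx
  exact Prod.ext rfl hx.symm

theorem preimage_snd_compl :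
    (Prod.snd ⁻¹' {0} : Set RZ2)ᶜ = Prod.snd ⁻¹' {1} := by
  ext ⟨t, k⟩
  simp only [Set.mem_compl_iff, Set.mem_preimage, Set.mem_singleton_iff]
  revert k
  decide

theorem eq_slice_add_slice (M : Measure RZ2) :
    M = (slice M 0).map (fun t => (t, 0)) + (slice M 1).map (fun t => (t, 1)) := by
  rw [slice_map, slice_map, ← preimage_snd_compl,
    Measure.restrict_add_restrict_compl (measurable_snd (measurableSet_singleton _))]

theorem map_fst_eq_slice_add_slice (M : Measure RZ2) :
    M.map Prod.fst = slice M 0 + slice M 1 := by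
  conv_lhs => rw [eq_slice_add_slice M]
  rw [Measure.map_add _ _ measurable_fst, Measure.map_map measurable_fst (by fun_prop),
    Measure.map_map measurable_fst (by fun_prop)]
  simp [Function.comp_def]

theorem continuous_pairR (s : ℝ) : Continuous fun t => pairR t s := by
  unfold pairR
  fun_prop

theorem continuous_pairRZ2 (y : RZ2) : Continuous fun x => pairRZ2 x y := by
  unfold pairRZ2
  refine ((continuous_pairR _).comp continuous_fst).mul ?_
  exact (continuous_of_discreteTopology (f := fun k : ZMod 2 => (-1 : ℂ) ^ (k * y.2).val)).comp
    continuous_snd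

theorem norm_pairR (t s : ℝ) : ‖pairR t s‖ = 1 := by
  rw [pairR, show Complex.I * t * s = ((t * s : ℝ) : ℂ) * Complex.I by push_cast; ring]
  exact Complex.norm_exp_ofReal_mul_I _

theorem norm_pairRZ2 (x y : RZ2) : ‖pairRZ2 x y‖ = 1 := by
  simp [pairRZ2, norm_pairR]

theorem integrable_pairRZ2 (M : Measure RZ2) [IsFiniteMeasure M] (y : RZ2) :
    Integrable (fun x => pairRZ2 x y) M :=
  Integrable.of_bound (continuous_pairRZ2 y).aestronglyMeasurable 1
    (Filter.Eventually.of_forall fun x => (norm_pairRZ2 x y).le)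

theorem charFn_pairR (μ : Measure ℝ) (s : ℝ) : charFn pairR μ s = charFun μ s := by
  rw [charFn, charFun_apply_real]
  congr with t
  rw [pairR]
  ring_nf

theorem charFn_pairRZ2 (M : Measure RZ2) [IsFiniteMeasure M] (s : ℝ) (l : ZMod 2) :
    charFn pairRZ2 M (s, l) = charFun (slice M 0) s + (-1) ^ l.val * charFun (slice M 1) s := by
  have h : ∀ k : ZMod 2, Measurable fun t : ℝ => ((t, k) : RZ2) := fun k => by fun_prop
  have hsm : ∀ N : Measure RZ2, AEStronglyMeasurable (fun x => pairRZ2 x (s, l)) N :=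
    fun N => (continuous_pairRZ2 _).aestronglyMeasurable
  rw [charFn]
  conv_lhs => rw [eq_slice_add_slice M]
  rw [integral_add_measure (integrable_pairRZ2 _ _) (integrable_pairRZ2 _ _),
    integral_map (h 0).aemeasurable (hsm _), integral_map (h 1).aemeasurable (hsm _),
    ← charFn_pairR, ← charFn_pairR, charFn, charFn, ← integral_const_mul]
  congr 1
  · simp [pairRZ2]
  · simp [pairRZ2, mul_comm]

theorem charFn_pairRZ2_zero (M : Measure RZ2) [IsFiniteMeasure M] (s : ℝ) :
    charFn pairRZ2 M (s, 0) = charFun (slice M 0) s + charFun (slice M 1) s := by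
  simp [charFn_pairRZ2]

theorem charFn_pairRZ2_one (M : Measure RZ2) [IsFiniteMeasure M] (s : ℝ) :
    charFn pairRZ2 M (s, 1) = charFun (slice M 0) s - charFun (slice M 1) s := by
  simp [charFn_pairRZ2, ZMod.val_one, sub_eq_add_neg]

theorem charFun_add_measure (μ ν : Measure ℝ) [IsFiniteMeasure μ] [IsFiniteMeasure ν] (s : ℝ) :
    charFun (μ + ν) s = charFun μ s + charFun ν s := by
  have h : ∀ (ρ : Measure ℝ) [IsFiniteMeasure ρ], Integrable (fun t => pairR t s) ρ := fun ρ _ =>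
    Integrable.of_bound (continuous_pairR s).aestronglyMeasurable 1
      (Filter.Eventually.of_forall fun x => (norm_pairR x s).le)
  simp only [← charFn_pairR, charFn]
  exact integral_add_measure (h μ) (h ν)

theorem charFun_smul_measure (c : ENNReal) (μ : Measure ℝ) (s : ℝ) :
    charFun (c • μ) s = c.toReal * charFun μ s := by
  simp only [← charFn_pairR, charFn]
  rw [integral_smul_measure, Complex.real_smul]

theorem charFun_map_fst (M : Measure RZ2) [IsFiniteMeasure M] (s : ℝ) :
    charFun (M.map Prod.fst) s = charFn pairRZ2 M (s, 0) := by
  rw [map_fst_eq_slice_add_slice, charFun_add_measure, charFn_pairRZ2_zero]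

/-- Uniqueness of characteristic functions on `ℝ × ℤ(2)`. -/
theorem ext_of_charFn_pairRZ2 {M N : Measure RZ2} [IsFiniteMeasure M] [IsFiniteMeasure N]
    (h0 : ∀ s, charFn pairRZ2 M (s, 0) = charFn pairRZ2 N (s, 0))
    (h1 : ∀ s, charFn pairRZ2 M (s, 1) = charFn pairRZ2 N (s, 1)) : M = N := by
  simp only [charFn_pairRZ2_zero] at h0
  simp only [charFn_pairRZ2_one] at h1
  have e0 : slice M 0 = slice N 0 :=
    Measure.ext_of_charFun (funext fun s => by linear_combination (h0 s + h1 s) / 2)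
  have e1 : slice M 1 = slice N 1 :=
    Measure.ext_of_charFun (funext fun s => by linear_combination (h0 s - h1 s) / 2)
  rw [eq_slice_add_slice M, eq_slice_add_slice N, e0, e1]

theorem continuous_charFn_pairRZ2 (M : Measure RZ2) [IsFiniteMeasure M] (k : ZMod 2) :
    Continuous fun s => charFn pairRZ2 M (s, k) := by
  simp only [charFn_pairRZ2]
  exact continuous_charFun.add (continuous_const.mul continuous_charFun)

theorem charFn_pairRZ2_neg (M : Measure RZ2) [IsFiniteMeasure M] (s : ℝ) (k : ZMod 2) :
    charFn pairRZ2 M (-s, k) = star (charFn pairRZ2 M (s, k)) := by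
  simp [charFn_pairRZ2, charFun_neg]

theorem norm_charFn_le_one {X Y : Type*} [MeasurableSpace X] {pair : X → Y → ℂ}
    (hpair : ∀ x y, ‖pair x y‖ = 1) (μ : Measure X) [IsProbabilityMeasure μ] (y : Y) :
    ‖charFn pair μ y‖ ≤ 1 := by
  have := norm_integral_le_of_norm_le_const (μ := μ) (C := 1)
    (Filter.Eventually.of_forall fun x => (hpair x y).le)
  simpa [charFn] using this

theorem charFn_pairRZ2_zero_zero (M : Measure RZ2) [IsProbabilityMeasure M] :
    charFn pairRZ2 M (0, 0) = 1 := by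
  simp [charFn, pairRZ2, pairR]

/-- The Gaussian distribution with characteristic function `e^{-σ s² + iβs}`. -/
noncomputable def gaussR (σ β : ℝ) : Measure ℝ := gaussianReal β (2 * σ).toNNReal

instance (σ β : ℝ) : IsProbabilityMeasure (gaussR σ β) := by
  unfold gaussR
  infer_instance

theorem charFun_gaussR {σ : ℝ} (hσ : 0 ≤ σ) (β s : ℝ) :
    charFun (gaussR σ β) s = Complex.exp (-(σ : ℂ) * s ^ 2 + Complex.I * β * s) := by
  rw [gaussR, charFun_gaussianReal]
  congr 1
  have : (((2 * σ).toNNReal : ℝ) : ℂ) = 2 * σ := by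
    rw [Real.coe_toNNReal _ (by linarith)]
    push_cast
    ring
  rw [this]
  ring

theorem isGaussianDist_gaussR {σ : ℝ} (hσ : 0 ≤ σ) (β : ℝ) :
    IsGaussianDist pairR (gaussR σ β) := by
  refine ⟨inferInstance, β, fun s => σ * s ^ 2, by fun_prop, fun s => by positivity,
    fun u v => by ring, fun s => ?_⟩
  rw [charFn_pairR, charFun_gaussR hσ, pairR, ← Complex.exp_add]
  congr 1
  push_cast
  ring

theorem map_fst_eq_gaussR {M : Measure RZ2} [IsProbabilityMeasure M] {σ β : ℝ} (hσ : 0 ≤ σ)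
    (h0 : ∀ s : ℝ, charFn pairRZ2 M (s, 0)
      = Complex.exp (-(σ : ℂ) * s ^ 2 + Complex.I * β * s)) :
    M.map Prod.fst = gaussR σ β := by
  have := Measure.isProbabilityMeasure_map (μ := M) (f := Prod.fst) measurable_fst.aemeasurable
  refine Measure.ext_of_charFun (funext fun s => ?_)
  rw [charFun_map_fst, h0, charFun_gaussR hσ]

theorem classLambda_of_charFn {M : Measure RZ2} [IsProbabilityMeasure M] {σ β : ℝ} (hσ : 0 ≤ σ)
    (h0 : ∀ s : ℝ, charFn pairRZ2 M (s, 0)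
      = Complex.exp (-(σ : ℂ) * s ^ 2 + Complex.I * β * s)) : ClassLambda M :=
  ⟨inferInstance, map_fst_eq_gaussR hσ h0 ▸ isGaussianDist_gaussR hσ β⟩

/-- If the projection of `M` to `ℝ` is Gaussian, both slices are dominated by it. -/
theorem analyticOnNhd_charFn_one {M : Measure RZ2} [IsProbabilityMeasure M] {σ β : ℝ}
    (hσ : 0 ≤ σ)
    (h0 : ∀ s : ℝ, charFn pairRZ2 M (s, 0)
      = Complex.exp (-(σ : ℂ) * s ^ 2 + Complex.I * β * s)) :
    AnalyticOnNhd ℝ (fun s => charFn pairRZ2 M (s, 1)) Set.univ := by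
  have h := (map_fst_eq_slice_add_slice M).symm.trans (map_fst_eq_gaussR hσ h0)
  simp only [charFn_pairRZ2_one]
  refine (analyticOnNhd_charFun_of_le_gaussianReal (m := β) (v := (2 * σ).toNNReal) ?_).sub
    (analyticOnNhd_charFun_of_le_gaussianReal (m := β) (v := (2 * σ).toNNReal) ?_)
  · exact (Measure.le_add_right le_rfl).trans h.le
  · exact (Measure.le_add_left le_rfl).trans h.le

/-- The inequality defining the class `Θ` comes from positivity of `M`: the difference of the two
slices is `κ` times a Gaussian measure, so `|κ|` times that measure is dominated by the sum of the
slices, again a Gaussian measure. -/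
theorem classTheta_of_charFn {M : Measure RZ2} [IsProbabilityMeasure M] {σ β σ' β' κ : ℝ}
    (hσ : 0 ≤ σ) (hσ' : 0 ≤ σ') (hκ : κ ≠ 0)
    (h0 : ∀ s : ℝ, charFn pairRZ2 M (s, 0)
      = Complex.exp (-(σ : ℂ) * s ^ 2 + Complex.I * β * s))
    (h1 : ∀ s : ℝ, charFn pairRZ2 M (s, 1)
      = κ * Complex.exp (-(σ' : ℂ) * s ^ 2 + Complex.I * β' * s)) : ClassTheta M := by
  refine ⟨inferInstance, σ, σ', β, β', κ, hσ, hσ', ?_, fun s => ⟨h0 s, h1 s⟩⟩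
  have hκ' := abs_pos.2 hκ
  have hsum := (map_fst_eq_slice_add_slice M).symm.trans (map_fst_eq_gaussR hσ h0)
  have hdiff : ∀ s, charFun (slice M 0) s - charFun (slice M 1) s
      = κ * charFun (gaussR σ' β') s := fun s => by
    rw [← charFn_pairRZ2_one, h1, charFun_gaussR hσ']
  have hfin : IsFiniteMeasure (ENNReal.ofReal |κ| • gaussR σ' β') :=
    Measure.smul_finite _ ENNReal.ofReal_ne_top
  have hle : ENNReal.ofReal |κ| • gaussR σ' β' ≤ gaussR σ β := by
    rw [← hsum]
    rcases lt_or_gt_of_ne hκ with hneg | hpos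
    · have : slice M 1 = slice M 0 + ENNReal.ofReal |κ| • gaussR σ' β' := by
        refine Measure.ext_of_charFun (funext fun s => ?_)
        rw [charFun_add_measure, charFun_smul_measure, ENNReal.toReal_ofReal (abs_nonneg _),
          abs_of_neg hneg]
        push_cast
        linear_combination -hdiff s
      rw [this]
      exact Measure.le_add_left (Measure.le_add_left le_rfl)
    · have : slice M 0 = slice M 1 + ENNReal.ofReal |κ| • gaussR σ' β' := by
        refine Measure.ext_of_charFun (funext fun s => ?_)
        rw [charFun_add_measure, charFun_smul_measure, ENNReal.toReal_ofReal (abs_nonneg _),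
          abs_of_pos hpos]
        linear_combination hdiff s
      rw [this]
      exact Measure.le_add_right (Measure.le_add_left le_rfl)
  have hr : ((2 * σ).toNNReal : ℝ) = 2 * σ := Real.coe_toNNReal _ (by linarith)
  have hr' : ((2 * σ').toNNReal : ℝ) = 2 * σ' := Real.coe_toNNReal _ (by linarith)
  rcases smul_gaussianReal_le hκ' hle with ⟨e1, e2, e3⟩ | ⟨e1, e2, e3⟩
  · right
    have e1' : ((2 * σ').toNNReal : ℝ) = (2 * σ).toNNReal := by rw [e1]
    rw [hr, hr'] at e1'
    exact ⟨by linarith, e2.symm, e3⟩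
  · left
    have e1' : (0 : ℝ) < (2 * σ').toNNReal := by exact_mod_cast e1
    have e2' : ((2 * σ').toNNReal : ℝ) < (2 * σ).toNNReal := by exact_mod_cast e2
    rw [hr'] at e1'
    rw [hr, hr'] at e2'
    rw [hr, hr'] at e3
    refine ⟨by linarith, by linarith, hκ', ?_⟩
    convert e3 using 3
    · rw [mul_div_mul_left _ _ two_ne_zero]
    · ring

/-! ### Characters -/

theorem continuous_pairRT (y : ℝ × ℤ) : Continuous fun x => pairRT x y := by
  unfold pairRT
  refine ((continuous_pairR _).comp continuous_fst).mul ?_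
  have h : Continuous fun x : RT => x.2.toMul ^ y.2 :=
    (continuous_zpow y.2).comp (continuous_toMul.comp continuous_snd)
  have h' : Continuous fun x : RT => ((x.2.toMul ^ y.2 : Circle) : ℂ) :=
    continuous_subtype_val.comp h
  simpa only [Circle.coe_zpow] using h'

theorem norm_pairRT (x : RT) (y : ℝ × ℤ) : ‖pairRT x y‖ = 1 := by
  rw [pairRT, norm_mul, norm_pairR, norm_zpow, Circle.norm_coe, one_zpow, mul_one]

theorem pairR_add_left (t t' s : ℝ) : pairR (t + t') s = pairR t s * pairR t' s := by
  simp only [pairR, ← Complex.exp_add]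
  congr 1
  push_cast
  ring

theorem pairR_add_right (t s s' : ℝ) : pairR t (s + s') = pairR t s * pairR t s' := by
  simp only [pairR, ← Complex.exp_add]
  congr 1
  push_cast
  ring

theorem pairRT_add_left (x x' : RT) (y : ℝ × ℤ) :
    pairRT (x + x') y = pairRT x y * pairRT x' y := by
  simp only [pairRT, Prod.fst_add, Prod.snd_add, pairR_add_left, toMul_add, Circle.coe_mul,
    mul_zpow]
  ring

theorem pairRT_add_right (x : RT) (y y' : ℝ × ℤ) :
    pairRT x (y + y') = pairRT x y * pairRT x y' := by
  simp only [pairRT, Prod.fst_add, Prod.snd_add, pairR_add_right]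
  rw [zpow_add₀ (Circle.coe_ne_zero _)]
  ring

theorem pairRT_zero_right (x : RT) : pairRT x 0 = 1 := by
  simp [pairRT, pairR]

theorem pairRT_neg (x : RT) (y : ℝ × ℤ) : pairRT (-x) y = pairRT x (-y) := by
  have h1 : pairRT (-x) y * pairRT x y = 1 := by
    rw [← pairRT_add_left]
    simp [pairRT, pairR]
  have h2 : pairRT x (-y) * pairRT x y = 1 := by
    rw [← pairRT_add_right, neg_add_cancel, pairRT_zero_right]
  have h3 : pairRT x y ≠ 0 := by
    rw [← norm_ne_zero_iff, norm_pairRT]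
    exact one_ne_zero
  exact mul_right_cancel₀ h3 (h1.trans h2.symm)

theorem coe_exp_zpow (θ : ℝ) (n : ℤ) : ((Circle.exp θ : Circle) : ℂ) ^ n = pairR θ n := by
  rw [Circle.coe_exp, ← Complex.exp_int_mul, pairR]
  congr 1
  push_cast
  ring

theorem pairR_mul_left (c t s : ℝ) : pairR (c * t) s = pairR t (c * s) := by
  simp only [pairR]
  congr 1
  push_cast
  ring

/-- The adjoint of `matMap a b` is `(s, n) ↦ (a s + b n, n)`. -/
theorem pairRT_matMap (a b : ℝ) (x : RT) (s : ℝ) (n : ℤ) :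
    pairRT (matMap a b x) (s, n) = pairRT x (a * s + b * n, n) := by
  simp only [pairRT, matMap, toMul_ofMul, Circle.coe_mul, mul_zpow, coe_exp_zpow, pairR_add_right,
    pairR_mul_left]
  ring

theorem pairRZ2_add_left (x x' y : RZ2) : pairRZ2 (x + x') y = pairRZ2 x y * pairRZ2 x' y := by
  have h : ∀ k k' l : ZMod 2,
      (-1 : ℂ) ^ ((k + k') * l).val = (-1) ^ (k * l).val * (-1) ^ (k' * l).val := by
    intro k k' l
    rw [← pow_add]
    refine neg_one_pow_congr ?_
    revert k k' l
    decide
  simp only [pairRZ2, Prod.fst_add, Prod.snd_add, pairR_add_left, h]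
  ring

theorem charFn_conv {X Y : Type*} [MeasurableSpace X] [AddCommGroup X] [TopologicalSpace X]
    [OpensMeasurableSpace X] [MeasurableAdd₂ X]
    {pair : X → Y → ℂ} {y : Y} (hc : Continuous fun x => pair x y)
    (hadd : ∀ x x', pair (x + x') y = pair x y * pair x' y) (μ ν : Measure X)
    [IsFiniteMeasure μ] [IsFiniteMeasure ν] :
    charFn pair (μ ∗ ν) y = charFn pair μ y * charFn pair ν y := by
  rw [charFn, Measure.conv, integral_map (by fun_prop) hc.measurable.aestronglyMeasurable]
  simp only [hadd]
  rw [integral_prod_mul (fun x => pair x y) (fun x => pair x y), charFn, charFn]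

/-! ### The functional equation -/

/-- Conditional symmetry of `L₂` given `L₁` means that `(L₁, -L₂)` and `(L₁, L₂)` have the same law.
-/
theorem map_prodMk_neg_of_condSymmetric {Ω X : Type*} [MeasurableSpace Ω] (P : Measure Ω)
    [IsFiniteMeasure P] [AddCommGroup X] [MeasurableSpace X] [StandardBorelSpace X]
    [MeasurableNeg X] {L₂ L₁ : Ω → X} (h₁ : Measurable L₁) (h₂ : Measurable L₂)
    (h : CondSymmetric P L₂ L₁) :
    P.map (fun ω => (L₁ ω, -L₂ ω)) = P.map (fun ω => (L₁ ω, L₂ ω)) := by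
  have h3 : (condDistrib L₂ L₁ P).map (fun y => -y) =ᵐ[P.map L₁] condDistrib L₂ L₁ P := by
    filter_upwards [h] with x hx
    rw [Kernel.map_apply _ measurable_neg, hx]
  have h4 := Measure.compProd_congr h3
  rw [Measure.compProd_map measurable_neg, compProd_map_condDistrib h₂.aemeasurable,
    Measure.map_map (by fun_prop) (by fun_prop)] at h4
  exact h4

theorem heyde_functional_equation {Ω : Type*} [MeasurableSpace Ω] {P : Measure Ω}
    [IsProbabilityMeasure P] {a b : ℝ} {α : RT → RT} (hα : ∀ x, α x = matMap a b x)
    (hαm : Measurable α) {ξ₁ ξ₂ : Ω → RT} (hξ₁ : Measurable ξ₁) (hξ₂ : Measurable ξ₂)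
    (hind : IndepFun ξ₁ ξ₂ P)
    (hsymm : CondSymmetric P (fun ω => ξ₁ ω + α (ξ₂ ω)) (fun ω => ξ₁ ω + ξ₂ ω))
    (u v : ℝ) (m l : ℤ) :
    charFn pairRT (P.map ξ₁) (u + v, m + l) *
        charFn pairRT (P.map ξ₂) (u + (a * v + b * l), m + l) =
      charFn pairRT (P.map ξ₁) (u - v, m - l) *
        charFn pairRT (P.map ξ₂) (u - (a * v + b * l), m - l) := by
  have hm : ∀ y, Measurable fun x => pairRT x y := fun y => (continuous_pairRT y).measurable
  have hL₁ : Measurable fun ω => ξ₁ ω + ξ₂ ω := hξ₁.add hξ₂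
  have hL₂ : Measurable fun ω => ξ₁ ω + α (ξ₂ ω) := hξ₁.add (hαm.comp hξ₂)
  have hm₁ : Measurable fun ω => (ξ₁ ω + ξ₂ ω, ξ₁ ω + α (ξ₂ ω)) := hL₁.prodMk hL₂
  have hm₂ : Measurable fun ω => (ξ₁ ω + ξ₂ ω, -(ξ₁ ω + α (ξ₂ ω))) := hL₁.prodMk hL₂.neg
  have hJ := map_prodMk_neg_of_condSymmetric P hL₁ hL₂ hsymm
  have hprod : ∀ y y' : ℝ × ℤ, ∫ ω, pairRT (ξ₁ ω) y * pairRT (ξ₂ ω) y' ∂P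
      = charFn pairRT (P.map ξ₁) y * charFn pairRT (P.map ξ₂) y' := by
    intro y y'
    rw [charFn, charFn, integral_map hξ₁.aemeasurable (hm y).aestronglyMeasurable,
      integral_map hξ₂.aemeasurable (hm y').aestronglyMeasurable]
    exact (hind.comp (hm y) (hm y')).integral_fun_mul_eq_mul_integral
      ((hm y).comp hξ₁).aestronglyMeasurable ((hm y').comp hξ₂).aestronglyMeasurable
  have hF : Measurable fun q : RT × RT => pairRT q.1 (u, m) * pairRT q.2 (v, l) :=
    ((hm _).comp measurable_fst).mul ((hm _).comp measurable_snd)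
  have hα' : ∀ x (s : ℝ) (n : ℤ), pairRT (α x) (s, n) = pairRT x (a * s + b * n, n) :=
    fun x s n => by rw [hα, pairRT_matMap]
  have e3 : ∀ ω, pairRT (ξ₁ ω + ξ₂ ω) (u, m) * pairRT (ξ₁ ω + α (ξ₂ ω)) (v, l)
      = pairRT (ξ₁ ω) (u + v, m + l) * pairRT (ξ₂ ω) (u + (a * v + b * l), m + l) := by
    intro ω
    rw [pairRT_add_left, pairRT_add_left, hα', ← Prod.mk_add_mk, pairRT_add_right,
      ← Prod.mk_add_mk, pairRT_add_right]
    ring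
  have e4 : ∀ ω, pairRT (ξ₁ ω + ξ₂ ω) (u, m) * pairRT (-(ξ₁ ω + α (ξ₂ ω))) (v, l)
      = pairRT (ξ₁ ω) (u - v, m - l) * pairRT (ξ₂ ω) (u - (a * v + b * l), m - l) := by
    intro ω
    have hneg : pairRT (α (ξ₂ ω)) (-v, -l) = pairRT (ξ₂ ω) (-(a * v + b * l), -l) := by
      rw [hα']
      congr 2
      push_cast
      ring
    rw [pairRT_neg, pairRT_add_left, pairRT_add_left, Prod.neg_mk, hneg, sub_eq_add_neg,
      sub_eq_add_neg, sub_eq_add_neg, ← Prod.mk_add_mk, pairRT_add_right,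
      ← Prod.mk_add_mk, pairRT_add_right]
    ring
  rw [← hprod, ← hprod, ← integral_congr_ae (Filter.Eventually.of_forall e3),
    ← integral_congr_ae (Filter.Eventually.of_forall e4)]
  have hint := congrArg (fun N => ∫ q, pairRT q.1 (u, m) * pairRT q.2 (v, l) ∂N) hJ
  rw [integral_map hm₂.aemeasurable hF.aestronglyMeasurable,
    integral_map hm₁.aemeasurable hF.aestronglyMeasurable] at hint
  exact hint.symm

/-! ### Concentration -/

theorem exists_ae_eq_const_of_norm_integral {X : Type*} [MeasurableSpace X] {μ : Measure X}
    [IsProbabilityMeasure μ] {h : X → ℂ} (hn : ∀ x, ‖h x‖ ≤ 1) (h1 : ‖∫ x, h x ∂μ‖ = 1) :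
    ∃ C, ∀ᵐ x ∂μ, h x = C := by
  rcases ae_eq_const_or_norm_integral_lt_of_norm_le_const
    (Filter.Eventually.of_forall hn : ∀ᵐ x ∂μ, ‖h x‖ ≤ 1) with h2 | h2
  · exact ⟨_, h2⟩
  · simp [h1] at h2

/-- If `|μ̂| = 1` on `ℝ × {0}`, the projection of `μ` to `ℝ` is degenerate. -/
theorem exists_ae_fst_eq {μ : Measure RT} [IsProbabilityMeasure μ]
    (h : ∀ s, ‖charFn pairRT μ (s, 0)‖ = 1) : ∃ t₀, ∀ᵐ x ∂μ, x.1 = t₀ := by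
  have hs : ∀ s, ∃ C, ∀ᵐ x ∂μ, pairRT x (s, 0) = C := fun s =>
    exists_ae_eq_const_of_norm_integral (fun x => (norm_pairRT x _).le) (h s)
  -- Two frequencies with irrational ratio determine `t`.
  obtain ⟨C, hC⟩ := hs (2 * Real.pi)
  obtain ⟨D, hD⟩ := hs (2 * Real.pi * √2)
  obtain ⟨x₀, hx₀, hx₀'⟩ := (hC.and hD).exists
  refine ⟨x₀.1, ?_⟩
  filter_upwards [hC, hD] with x hx hx'
  rw [← hx₀] at hx
  rw [← hx₀'] at hx'
  simp only [pairRT, zpow_zero, mul_one, pairR, Complex.exp_eq_exp_iff_exists_int] at hx hx'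
  obtain ⟨k, hk⟩ := hx
  obtain ⟨l, hl⟩ := hx'
  have hne := Complex.two_pi_I_ne_zero
  have hk' : x.1 - x₀.1 = k := by
    have : ((x.1 - x₀.1 : ℝ) : ℂ) = (k : ℝ) := by
      apply mul_right_cancel₀ hne
      push_cast at hk ⊢
      linear_combination hk
    exact_mod_cast this
  have hl' : (x.1 - x₀.1) * √2 = l := by
    have : (((x.1 - x₀.1) * √2 : ℝ) : ℂ) = (l : ℝ) := by
      apply mul_right_cancel₀ hne
      push_cast at hl ⊢
      linear_combination hl
    exact_mod_cast this
  by_contra hcon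
  have hk0 : (k : ℝ) ≠ 0 := by
    rw [← hk']
    exact sub_ne_zero.2 hcon
  refine irrational_sqrt_two.ne_rational l k ?_
  rw [hk'] at hl'
  field_simp
  linarith

/-- If `|μ̂(-2c, 2)| = 1`, then `(e^{-ict} w)²` is almost surely constant. -/
theorem exists_ae_eq_or_eq_neg {μ : Measure RT} [IsProbabilityMeasure μ] {c : ℝ}
    (h : ‖charFn pairRT μ (-(2 * c), 2)‖ = 1) :
    ∃ z : Circle, ∀ᵐ x ∂μ, Circle.exp (-(c * x.1)) * x.2.toMul = z ∨
      Circle.exp (-(c * x.1)) * x.2.toMul = -z := by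
  obtain ⟨C, hC⟩ := exists_ae_eq_const_of_norm_integral (fun x => (norm_pairRT x _).le) h
  have hsq : ∀ x : RT, pairRT x (-(2 * c), 2)
      = ((Circle.exp (-(c * x.1)) * x.2.toMul : Circle) : ℂ) ^ 2 := by
    intro x
    rw [Circle.coe_mul, mul_pow, pairRT]
    congr 1
    rw [← zpow_natCast, coe_exp_zpow, pairR, pairR]
    congr 1
    push_cast
    ring
  obtain ⟨x₀, hx₀⟩ := hC.exists
  refine ⟨Circle.exp (-(c * x₀.1)) * x₀.2.toMul, ?_⟩
  filter_upwards [hC] with x hx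
  rw [← hx₀, hsq, hsq, sq_eq_sq_iff_eq_or_eq_neg] at hx
  rcases hx with hx | hx
  · exact Or.inl (Circle.ext hx)
  · exact Or.inr (Circle.ext (by rw [hx]; rfl))

/-! ### The homomorphism `τ` -/

/-- The homomorphism `(t, k) ↦ (t, (-1)^k e^{ict})`. -/
noncomputable def tauHom (c : ℝ) : RZ2 →+ RT where
  toFun p := (p.1, Additive.ofMul ((-1) ^ p.2.val * Circle.exp (c * p.1)))
  map_zero' := by simp
  map_add' p q := by
    refine Prod.ext rfl ?_
    have h : ∀ k l : ZMod 2, (-1 : Circle) ^ (k + l).val = (-1) ^ k.val * (-1) ^ l.val := by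
      intro k l
      rw [← pow_add]
      refine neg_one_pow_congr ?_
      revert k l
      decide
    apply Additive.toMul.injective
    simp only [Prod.fst_add, Prod.snd_add, toMul_add, toMul_ofMul, mul_add, Circle.exp_add, h]
    exact mul_mul_mul_comm _ _ _ _

theorem tau_eq_tauHom (a b : ℝ) : tau a b = tauHom (b / (a - 1)) := by
  funext p
  simp only [tau, tauHom, AddMonoidHom.coe_mk, ZeroHom.coe_mk]
  rw [div_mul_eq_mul_div]

theorem continuous_tauHom (c : ℝ) : Continuous (tauHom c) := by
  have h : Continuous fun k : ZMod 2 => (-1 : Circle) ^ k.val := continuous_of_discreteTopology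
  exact continuous_fst.prodMk (continuous_ofMul.comp ((h.comp continuous_snd).mul
    (Circle.exp.continuous.comp (continuous_const.mul continuous_fst))))

theorem pairRT_tauHom (c : ℝ) (p : RZ2) (s : ℝ) (n : ℤ) :
    pairRT (tauHom c p) (s, n) = pairRZ2 p (s + c * n, n) := by
  have h : ((-1 : ℂ) ^ p.2.val) ^ n = (-1) ^ (p.2 * (n : ZMod 2)).val := by
    obtain ⟨t, k⟩ := p
    have hk : k = 0 ∨ k = 1 := by revert k; decide
    rcases hk with rfl | rfl
    · simp
    · rcases Int.even_or_odd n with hn | hn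
      · have : (n : ZMod 2) = 0 := (ZMod.intCast_eq_zero_iff_even).2 hn
        simp [this, hn.neg_one_zpow, ZMod.val_one]
      · have : (n : ZMod 2) = 1 := (ZMod.intCast_eq_one_iff_odd).2 hn
        simp [this, hn.neg_one_zpow, ZMod.val_one]
  simp only [pairRT, tauHom, AddMonoidHom.coe_mk, ZeroHom.coe_mk, toMul_ofMul, Circle.coe_mul,
    mul_zpow, coe_exp_zpow, pairRZ2, pairR_add_right, pairR_mul_left, ← h]
  push_cast
  ring

theorem charFn_map_tauHom (c : ℝ) (M : Measure RZ2) (s : ℝ) (n : ℤ) :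
    charFn pairRT (M.map (tauHom c)) (s, n) = charFn pairRZ2 M (s + c * n, n) := by
  rw [charFn, integral_map (continuous_tauHom c).measurable.aemeasurable
    (continuous_pairRT _).measurable.aestronglyMeasurable, charFn]
  simp only [pairRT_tauHom]

theorem charFn_map_tauHom_conv_dirac_ne_zero {c : ℝ} {M : Measure RZ2} [IsFiniteMeasure M]
    (h0 : ∀ s, charFn pairRZ2 M (s, 0) ≠ 0) (h1 : ∀ s, charFn pairRZ2 M (s, 1) ≠ 0)
    (x : RT) (y : ℝ × ℤ) : charFn pairRT (M.map (tauHom c) ∗ Measure.dirac x) y ≠ 0 := by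
  rw [charFn_conv (continuous_pairRT y) (fun x x' => pairRT_add_left x x' y)]
  obtain ⟨s, n⟩ := y
  refine mul_ne_zero ?_ ?_
  · rw [charFn_map_tauHom]
    rcases (by decide : ∀ k : ZMod 2, k = 0 ∨ k = 1) (n : ZMod 2) with h | h
    · rw [h]; exact h0 _
    · rw [h]; exact h1 _
  · rw [charFn, integral_dirac' _ _ (continuous_pairRT _).measurable.stronglyMeasurable,
      ← norm_ne_zero_iff, norm_pairRT]
    exact one_ne_zero

/-- A measure carried, up to the translation `(0, z)`, by the range of `tauHom c` is the image of
a measure on `ℝ × ℤ(2)`. -/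
theorem exists_eq_map_tauHom {μ : Measure RT} [IsProbabilityMeasure μ] {c : ℝ} {z : Circle}
    (h : ∀ᵐ x ∂μ, Circle.exp (-(c * x.1)) * x.2.toMul = z ∨
      Circle.exp (-(c * x.1)) * x.2.toMul = -z) :
    ∃ M : Measure RZ2, IsProbabilityMeasure M ∧
      μ = M.map (tauHom c) ∗ Measure.dirac ((0, Additive.ofMul z) : RT) := by
  classical
  set ρ : RT → RZ2 := fun x => (x.1, if Circle.exp (-(c * x.1)) * x.2.toMul = z then 0 else 1)
  have hcont : Continuous fun x : RT => Circle.exp (-(c * x.1)) * x.2.toMul :=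
    (Circle.exp.continuous.comp (by fun_prop)).mul (continuous_toMul.comp continuous_snd)
  have hρ : Measurable ρ := measurable_fst.prodMk (Measurable.ite
    (isClosed_eq hcont continuous_const).measurableSet measurable_const measurable_const)
  have hp : IsProbabilityMeasure (μ.map ρ) := Measure.isProbabilityMeasure_map hρ.aemeasurable
  refine ⟨μ.map ρ, hp, ?_⟩
  have hτ := (continuous_tauHom c).measurable
  have hp' : IsProbabilityMeasure ((μ.map ρ).map (tauHom c)) :=
    Measure.isProbabilityMeasure_map hτ.aemeasurable
  rw [Measure.conv_dirac, Measure.map_map (by fun_prop) hτ, Measure.map_map (by fun_prop) hρ]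
  conv_lhs => rw [← Measure.map_id (μ := μ)]
  refine Measure.map_congr ?_
  filter_upwards [h] with x hx
  have hexp : Circle.exp (c * x.1) * Circle.exp (-(c * x.1)) = 1 := by
    rw [← Circle.exp_add, add_neg_cancel, Circle.exp_zero]
  refine Prod.ext (by simp [ρ, tauHom]) (Additive.toMul.injective ?_)
  by_cases h1 : Circle.exp (-(c * x.1)) * x.2.toMul = z
  · simp only [ρ, tauHom, h1, Function.comp, AddMonoidHom.coe_mk, ZeroHom.coe_mk, if_true, id,
      Prod.snd_add, toMul_add, toMul_ofMul, ZMod.val_zero, pow_zero, one_mul]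
    rw [← h1, ← mul_assoc, hexp, one_mul]
  · simp only [ρ, tauHom, h1, Function.comp, AddMonoidHom.coe_mk, ZeroHom.coe_mk, if_false, id,
      Prod.snd_add, toMul_add, toMul_ofMul, ZMod.val_one, pow_one]
    have h2 := hx.resolve_left h1
    rw [neg_one_mul, neg_mul, ← mul_neg, ← h2, ← mul_assoc, hexp, one_mul]

/-! ### Reduction to `ℝ × ℤ(2)` -/

/-- Heyde's functional equation `μ̂₁(y + y') μ̂₂(y + α̃ y') = μ̂₁(y - y') μ̂₂(y - α̃ y')` on `ℝ ×
ℤ`, with `y = (u, m)`, `y' = (v, l)` and `α̃` the adjoint of `matMap a b`. -/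
def HeydeEq (a b : ℝ) (μ₁ μ₂ : Measure RT) : Prop :=
  ∀ (u v : ℝ) (m l : ℤ),
    charFn pairRT μ₁ (u + v, m + l) * charFn pairRT μ₂ (u + (a * v + b * l), m + l) =
      charFn pairRT μ₁ (u - v, m - l) * charFn pairRT μ₂ (u - (a * v + b * l), m - l)

theorem charFn_pairRT_zero_zero (μ : Measure RT) [IsProbabilityMeasure μ] :
    charFn pairRT μ (0, 0) = 1 := by
  simp [charFn, pairRT, pairR]

theorem norm_eq_one_of_mul_eq_one {x y : ℂ} (hx : ‖x‖ ≤ 1) (hy : ‖y‖ ≤ 1) (h : ‖x * y‖ = 1) :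
    ‖x‖ = 1 ∧ ‖y‖ = 1 := by
  rw [norm_mul] at h
  have := norm_nonneg x
  have := norm_nonneg y
  constructor <;> nlinarith

/-- With `y = y' = (-c, 1)`, `c = b / (a - 1)`, one has `α̃ y' = y'`, so that the right-hand side of
the equation is `1`. -/
theorem HeydeEq.norm_charFn_two {a b : ℝ} {μ₁ μ₂ : Measure RT} [IsProbabilityMeasure μ₁]
    [IsProbabilityMeasure μ₂] (H : HeydeEq a b μ₁ μ₂) (ha : a ≠ 1) :
    ‖charFn pairRT μ₁ (-(2 * (b / (a - 1))), 2)‖ = 1 ∧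
      ‖charFn pairRT μ₂ (-(2 * (b / (a - 1))), 2)‖ = 1 := by
  obtain ⟨c, hc⟩ : ∃ c, c = b / (a - 1) := ⟨_, rfl⟩
  have hc' : b = c * (a - 1) := by
    rw [hc, div_mul_cancel₀ _ (sub_ne_zero.2 ha)]
  rw [← hc]
  refine norm_eq_one_of_mul_eq_one (norm_charFn_le_one norm_pairRT _ _)
    (norm_charFn_le_one norm_pairRT _ _) ?_
  have := H (-c) (-c) 1 1
  rw [show -c + (a * -c + b * (1 : ℤ)) = -(2 * c) by rw [hc']; push_cast; ring,
    show -c - (a * -c + b * (1 : ℤ)) = 0 by rw [hc']; push_cast; ring,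
    show -c + -c = -(2 * c) by ring, sub_self, sub_self, charFn_pairRT_zero_zero,
    charFn_pairRT_zero_zero, one_mul, one_add_one_eq_two] at this
  rw [this, norm_one]

theorem charFn_translate_tauHom (c : ℝ) (M : Measure RZ2) [IsFiniteMeasure M] (z : Circle) (s : ℝ)
    (n : ℤ) : charFn pairRT (M.map (tauHom c) ∗ Measure.dirac ((0, Additive.ofMul z) : RT)) (s, n)
      = charFn pairRZ2 M (s + c * n, n) * (z : ℂ) ^ n := by
  rw [charFn_conv (continuous_pairRT _) (fun x x' => pairRT_add_left x x' _), charFn_map_tauHom]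
  congr 1
  rw [charFn, integral_dirac' _ _ (continuous_pairRT _).measurable.stronglyMeasurable]
  simp [pairRT, pairR]

/-- Both components of the characteristic functions on `ℝ × ℤ(2)` satisfy Heyde's equation on the
line. -/
theorem HeydeEq.charFn_pairRZ2 {a b : ℝ} {M₁ M₂ : Measure RZ2} [IsFiniteMeasure M₁]
    [IsFiniteMeasure M₂] {z₁ z₂ : Circle}
    (H : HeydeEq a b (M₁.map (tauHom (b / (a - 1))) ∗ Measure.dirac ((0, Additive.ofMul z₁) : RT))
      (M₂.map (tauHom (b / (a - 1))) ∗ Measure.dirac ((0, Additive.ofMul z₂) : RT)))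
    (k : ZMod 2) (u v : ℝ) :
    charFn pairRZ2 M₁ (u + v, k) * charFn pairRZ2 M₂ (u + a * v, k) =
      charFn pairRZ2 M₁ (u - v, k) * charFn pairRZ2 M₂ (u - a * v, k) := by
  obtain ⟨c, hc⟩ : ∃ c, c = b / (a - 1) := ⟨_, rfl⟩
  rw [← hc] at H
  obtain ⟨n, rfl⟩ := ZMod.intCast_surjective k
  have := H (u - c * n) v n 0
  simp only [add_zero, sub_zero, Int.cast_zero, mul_zero, charFn_translate_tauHom] at this
  rw [show u - c * n + v + c * n = u + v by ring,
    show u - c * n + a * v + c * n = u + a * v by ring,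
    show u - c * n - v + c * n = u - v by ring,
    show u - c * n - a * v + c * n = u - a * v by ring] at this
  have h1 : (z₁ : ℂ) ^ n ≠ 0 := zpow_ne_zero _ (Circle.coe_ne_zero _)
  have h2 : (z₂ : ℂ) ^ n ≠ 0 := zpow_ne_zero _ (Circle.coe_ne_zero _)
  apply mul_right_cancel₀ (mul_ne_zero h1 h2)
  linear_combination this

/-- For `a ≠ 1` both distributions are translates of `τ`-images of distributions on `ℝ × ℤ(2)`,
whose characteristic functions satisfy Heyde's equation on `ℝ × {0}` and on `ℝ × {1}` separately. -/
theorem HeydeEq.exists_eq_map_tauHom {a b : ℝ} {μ₁ μ₂ : Measure RT} [IsProbabilityMeasure μ₁]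
    [IsProbabilityMeasure μ₂] (H : HeydeEq a b μ₁ μ₂) (ha : a ≠ 1) :
    ∃ (x₁ x₂ : RT) (M₁ M₂ : Measure RZ2), IsProbabilityMeasure M₁ ∧ IsProbabilityMeasure M₂ ∧
      μ₁ = M₁.map (tauHom (b / (a - 1))) ∗ Measure.dirac x₁ ∧
      μ₂ = M₂.map (tauHom (b / (a - 1))) ∗ Measure.dirac x₂ ∧
      (∀ s, charFn pairRZ2 M₁ (s, 0) = charFn pairRT μ₁ (s, 0)) ∧
      (∀ s, charFn pairRZ2 M₂ (s, 0) = charFn pairRT μ₂ (s, 0)) ∧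
      ∀ k u v, charFn pairRZ2 M₁ (u + v, k) * charFn pairRZ2 M₂ (u + a * v, k) =
        charFn pairRZ2 M₁ (u - v, k) * charFn pairRZ2 M₂ (u - a * v, k) := by
  obtain ⟨z₁, hz₁⟩ := exists_ae_eq_or_eq_neg (H.norm_charFn_two ha).1
  obtain ⟨z₂, hz₂⟩ := exists_ae_eq_or_eq_neg (H.norm_charFn_two ha).2
  obtain ⟨M₁, hM₁, e₁⟩ := HeydeRT.exists_eq_map_tauHom hz₁
  obtain ⟨M₂, hM₂, e₂⟩ := HeydeRT.exists_eq_map_tauHom hz₂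
  refine ⟨_, _, M₁, M₂, hM₁, hM₂, e₁, e₂, fun s => ?_, fun s => ?_, ?_⟩
  · rw [e₁, charFn_translate_tauHom]
    simp
  · rw [e₂, charFn_translate_tauHom]
    simp
  · rw [e₁, e₂] at H
    exact H.charFn_pairRZ2

/-! ### Positive `a` -/

theorem mem_subG_iff {x : RT} : x ∈ subG ↔ x = 0 ∨ x = elemTwo := by
  have h2 : elemTwo + elemTwo = 0 := by
    refine Prod.ext (by simp [elemTwo]) (Additive.toMul.injective ?_)
    simp [elemTwo]
  rw [subG, AddSubgroup.mem_zmultiples_iff]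
  constructor
  · rintro ⟨n, rfl⟩
    rcases Int.even_or_odd' n with ⟨k, rfl | rfl⟩
    · left
      rw [mul_comm, mul_zsmul, two_zsmul, h2, zsmul_zero]
    · right
      rw [add_zsmul, mul_comm, mul_zsmul, two_zsmul, h2, zsmul_zero, zero_add, one_zsmul]
  · rintro (rfl | rfl)
    · exact ⟨0, zero_zsmul _⟩
    · exact ⟨1, one_zsmul _⟩

theorem measurableSet_subG : MeasurableSet (subG : Set RT) := by
  have : (subG : Set RT) = {0, elemTwo} := by
    ext x
    exact mem_subG_iff
  rw [this]
  exact (Set.toFinite _).measurableSet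

theorem exists_concentratedOn_subG {μ : Measure RT} [IsProbabilityMeasure μ] {c : ℝ}
    (h1 : ∀ s, ‖charFn pairRT μ (s, 0)‖ = 1) (h2 : ‖charFn pairRT μ (-(2 * c), 2)‖ = 1) :
    ∃ x, ConcentratedOn (μ ∗ Measure.dirac x) (subG : Set RT) := by
  obtain ⟨t₀, ht⟩ := exists_ae_fst_eq h1
  obtain ⟨z, hz⟩ := exists_ae_eq_or_eq_neg h2
  refine ⟨-(t₀, Additive.ofMul (Circle.exp (c * t₀) * z)), inferInstance, ?_⟩
  rw [Measure.conv_dirac, Measure.map_apply (by fun_prop) measurableSet_subG.compl]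
  change ∀ᵐ x ∂μ, x + -(t₀, Additive.ofMul (Circle.exp (c * t₀) * z)) ∈ subG
  filter_upwards [ht, hz] with x hx hx'
  have hexp : Circle.exp (-(c * t₀)) = (Circle.exp (c * t₀))⁻¹ := Circle.exp_neg _
  rw [hx, hexp, inv_mul_eq_iff_eq_mul, inv_mul_eq_iff_eq_mul] at hx'
  rw [mem_subG_iff]
  refine hx'.imp (fun h => ?_) fun h => ?_
  · refine Prod.ext (by simp [hx]) (Additive.toMul.injective ?_)
    simp [h]
  · refine Prod.ext (by simp [hx, elemTwo]) (Additive.toMul.injective ?_)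
    simp only [Prod.snd_add, Prod.snd_neg, toMul_add, toMul_neg, toMul_ofMul, h, elemTwo,
      mul_neg, neg_mul, mul_inv_cancel]

theorem HeydeEq.concentratedOn_subG {a b : ℝ} {μ₁ μ₂ : Measure RT} [IsProbabilityMeasure μ₁]
    [IsProbabilityMeasure μ₂] (H : HeydeEq a b μ₁ μ₂) (ha : 0 < a) :
    ∃ x₁ x₂ : RT, ConcentratedOn (μ₁ ∗ Measure.dirac x₁) (subG : Set RT) ∧
      ConcentratedOn (μ₂ ∗ Measure.dirac x₂) (subG : Set RT) := by
  suffices h : (∀ s, ‖charFn pairRT μ₁ (s, 0)‖ = 1 ∧ ‖charFn pairRT μ₂ (s, 0)‖ = 1) ∧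
      ∃ c, ‖charFn pairRT μ₁ (-(2 * c), 2)‖ = 1 ∧ ‖charFn pairRT μ₂ (-(2 * c), 2)‖ = 1 by
    obtain ⟨h0, c, h1, h2⟩ := h
    obtain ⟨x₁, hx₁⟩ := exists_concentratedOn_subG (fun s => (h0 s).1) h1
    obtain ⟨x₂, hx₂⟩ := exists_concentratedOn_subG (fun s => (h0 s).2) h2
    exact ⟨x₁, x₂, hx₁, hx₂⟩
  have hb₁ : ∀ y, ‖charFn pairRT μ₁ y‖ ≤ 1 := norm_charFn_le_one norm_pairRT μ₁
  have hb₂ : ∀ y, ‖charFn pairRT μ₂ y‖ ≤ 1 := norm_charFn_le_one norm_pairRT μ₂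
  by_cases ha1 : a = 1
  · subst ha1
    -- Here `α̃ (s, n) = (s + b n, n)`; taking `y = y'` makes the first factor on the right `1`.
    have h0 : ∀ s, ‖charFn pairRT μ₁ (s, 0)‖ = 1 ∧ ‖charFn pairRT μ₂ (s, 0)‖ = 1 := by
      intro s
      refine norm_eq_one_of_mul_eq_one (hb₁ _) (hb₂ _) ?_
      have := H (s / 2) (s / 2) 0 0
      simp only [Int.cast_zero, mul_zero, add_zero, one_mul, sub_self, add_halves,
        charFn_pairRT_zero_zero] at this
      rw [this, norm_one]
    have h2 : ∀ s, ‖charFn pairRT μ₁ (2 * s, 2)‖ = 1 ∧ ‖charFn pairRT μ₂ (2 * s + b, 2)‖ = 1 := by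
      intro s
      refine norm_eq_one_of_mul_eq_one (hb₁ _) (hb₂ _) ?_
      have := H s s 1 1
      rw [sub_self, sub_self, charFn_pairRT_zero_zero, one_mul, one_mul, Int.cast_one, mul_one,
        one_add_one_eq_two, ← two_mul, ← add_assoc, ← two_mul] at this
      rw [this, (h0 _).2]
    refine ⟨h0, 0, ?_, ?_⟩
    · simpa using (h2 0).1
    · have := (h2 (-b / 2)).2
      rwa [show 2 * (-b / 2) + b = -(2 * 0) by ring] at this
  · refine ⟨fun s => ?_, _, H.norm_charFn_two ha1⟩
    obtain ⟨-, -, M₁, M₂, _, _, -, -, e₁, e₂, hM⟩ := H.exists_eq_map_tauHom ha1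
    obtain ⟨⟨σ₁, β₁, hσ₁, h₁⟩, σ₂, β₂, hσ₂, h₂⟩ := heyde_gaussian_form ha.ne' ha1 (by linarith)
      (continuous_charFn_pairRZ2 M₁ 0) (continuous_charFn_pairRZ2 M₂ 0)
      (by simp [charFn_pairRZ2_zero_zero]) (by simp [charFn_pairRZ2_zero_zero])
      (fun x => charFn_pairRZ2_neg M₁ x 0) (fun x => charFn_pairRZ2_neg M₂ x 0)
      (fun x => norm_charFn_le_one norm_pairRZ2 M₁ _)
      (fun x => norm_charFn_le_one norm_pairRZ2 M₂ _) (hM 0)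
    have hn : ∀ σ β s : ℝ, ‖Complex.exp (-(σ : ℂ) * s ^ 2 + Complex.I * β * s)‖
        = Real.exp (-(σ * s ^ 2)) := by
      intro σ β s
      rw [Complex.norm_exp]
      congr 1
      simp [← Complex.ofReal_pow]
    simp only [charFn_pairRZ2_zero_zero, one_mul] at h₁ h₂
    -- The moduli at `u = v = 1`; for `a > 0` the relation forces both variances to vanish.
    have hsum : σ₁ + a * σ₂ = 0 := by
      have := congrArg norm (hM 0 1 1)
      rw [norm_mul, norm_mul, h₁, h₁, h₂, h₂, hn, hn, hn, hn, ← Real.exp_add,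
        ← Real.exp_add] at this
      have := Real.exp_injective this
      linarith
    have hσ₂' : σ₂ = 0 := by nlinarith
    have hσ₁' : σ₁ = 0 := by rw [hσ₂'] at hsum; linarith
    rw [← e₁, ← e₂, h₁, h₂, hn, hn, hσ₁', hσ₂']
    simp

/-! ### Distributions on `ℝ × ℤ(2)` -/

/-- The distribution on `{0} × ℤ(2)` whose characteristic function is `1` at `0` and `κ` at `1`. -/
noncomputable def twoPoint (κ : ℝ) : Measure RZ2 :=
  ENNReal.ofReal ((1 + κ) / 2) • Measure.dirac 0 +
    ENNReal.ofReal ((1 - κ) / 2) • Measure.dirac (0, 1)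

theorem isProbabilityMeasure_twoPoint {κ : ℝ} (hκ : |κ| ≤ 1) :
    IsProbabilityMeasure (twoPoint κ) := by
  rw [abs_le] at hκ
  refine ⟨?_⟩
  simp only [twoPoint, Measure.add_apply, Measure.smul_apply, measure_univ, smul_eq_mul, mul_one]
  rw [← ENNReal.ofReal_add (by linarith) (by linarith)]
  norm_num [← add_div]

theorem charFn_twoPoint {κ : ℝ} (hκ : |κ| ≤ 1) (y : RZ2) :
    charFn pairRZ2 (twoPoint κ) y = (1 + κ) / 2 + (1 - κ) / 2 * (-1) ^ y.2.val := by
  have h := isProbabilityMeasure_twoPoint hκ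
  rw [abs_le] at hκ
  have hi := integrable_pairRZ2 (twoPoint κ) y
  rw [charFn, twoPoint, integral_add_measure (hi.mono_measure (Measure.le_add_right le_rfl))
    (hi.mono_measure (Measure.le_add_left le_rfl)), integral_smul_measure, integral_smul_measure,
    integral_dirac, integral_dirac, ENNReal.toReal_ofReal (by linarith),
    ENNReal.toReal_ofReal (by linarith)]
  simp [pairRZ2, pairR]

theorem eq_conv_twoPoint {M N : Measure RZ2} [IsFiniteMeasure M] [IsFiniteMeasure N] {κ : ℝ}
    (hκ : |κ| ≤ 1) (h0 : ∀ s, charFn pairRZ2 N (s, 0) = charFn pairRZ2 M (s, 0))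
    (h1 : ∀ s, charFn pairRZ2 N (s, 1) = κ * charFn pairRZ2 M (s, 1)) : N = M ∗ twoPoint κ := by
  have := isProbabilityMeasure_twoPoint hκ
  refine ext_of_charFn_pairRZ2 (fun s => ?_) fun s => ?_
  · rw [charFn_conv (continuous_pairRZ2 _) fun x x' => pairRZ2_add_left x x' _,
      charFn_twoPoint hκ, h0]
    simp
    ring
  · rw [charFn_conv (continuous_pairRZ2 _) fun x x' => pairRZ2_add_left x x' _,
      charFn_twoPoint hκ, h1]
    simp [ZMod.val_one]
    ring

theorem neg_one_ne_one_circle : (-1 : Circle) ≠ 1 := by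
  intro h
  have h' : ((-1 : Circle) : ℂ) = ((1 : Circle) : ℂ) := by rw [h]
  have h'' : (-1 : ℂ) = 1 := h'
  norm_num at h''

theorem tauHom_injective (c : ℝ) : Function.Injective (tauHom c) := by
  rw [injective_iff_map_eq_zero]
  rintro ⟨t, k⟩ h
  obtain ⟨h1, h2⟩ := Prod.ext_iff.1 h
  have ht : t = 0 := h1
  subst ht
  rcases (by decide : ∀ k : ZMod 2, k = 0 ∨ k = 1) k with rfl | rfl
  · rfl
  · have h3 := congrArg Additive.toMul h2
    simp [tauHom, ZMod.val_one] at h3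
    exact absurd h3 neg_one_ne_one_circle

theorem tauHom_zero_one (c : ℝ) : tauHom c (0, 1) = elemTwo := by
  refine Prod.ext rfl (Additive.toMul.injective ?_)
  simp [tauHom, elemTwo, ZMod.val_one]

theorem measurableEmbedding_tauHom (c : ℝ) : MeasurableEmbedding (tauHom c) :=
  (continuous_tauHom c).measurableEmbedding (tauHom_injective c)

theorem concentratedOn_map_tauHom (a b : ℝ) (M : Measure RZ2) [IsProbabilityMeasure M] :
    ConcentratedOn (M.map (tauHom (b / (a - 1)))) (subF a b + (subG : Set RT)) := by
  refine ⟨Measure.isProbabilityMeasure_map (continuous_tauHom _).measurable.aemeasurable, ?_⟩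
  rw [(measurableEmbedding_tauHom _).map_apply]
  convert measure_empty (μ := M)
  rw [Set.eq_empty_iff_forall_notMem]
  rintro ⟨t, k⟩ h
  refine h (Set.mem_add.2 ⟨tau a b (t, 0), ⟨t, rfl⟩, tauHom (b / (a - 1)) (0, k), ?_, ?_⟩)
  · rcases (by decide : ∀ k : ZMod 2, k = 0 ∨ k = 1) k with rfl | rfl
    · exact mem_subG_iff.2 (Or.inl (map_zero (tauHom (b / (a - 1)))))
    · exact mem_subG_iff.2 (Or.inr (tauHom_zero_one _))
  · rw [tau_eq_tauHom, ← map_add]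
    simp

theorem concentratedOn_map_twoPoint (c : ℝ) {κ : ℝ} (hκ : |κ| ≤ 1) :
    ConcentratedOn ((twoPoint κ).map (tauHom c)) (subG : Set RT) := by
  have := isProbabilityMeasure_twoPoint hκ
  refine ⟨Measure.isProbabilityMeasure_map (continuous_tauHom _).measurable.aemeasurable, ?_⟩
  rw [(measurableEmbedding_tauHom _).map_apply, twoPoint]
  have h0 : tauHom c 0 ∈ subG := mem_subG_iff.2 (Or.inl (map_zero _))
  have h1 : tauHom c (0, 1) ∈ subG := mem_subG_iff.2 (Or.inr (tauHom_zero_one _))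
  rw [map_zero] at h0
  simp [h1]

theorem map_twoPoint_zero (c : ℝ) : (twoPoint 0).map (tauHom c) = haarG := by
  have hm := (continuous_tauHom c).measurable
  rw [twoPoint, Measure.map_add _ _ hm, Measure.map_smul, Measure.map_smul,
    Measure.map_dirac' hm, Measure.map_dirac' hm, map_zero, tauHom_zero_one, haarG, smul_add]
  have h : ENNReal.ofReal (1 / 2) = 2⁻¹ := by
    rw [one_div, ENNReal.ofReal_inv_of_pos two_pos, ENNReal.ofReal_ofNat]
  rw [add_zero, sub_zero, h]

theorem map_tauHom_conv (c : ℝ) (M N : Measure RZ2) [IsFiniteMeasure M] [IsFiniteMeasure N] :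
    (M ∗ N).map (tauHom c) = M.map (tauHom c) ∗ N.map (tauHom c) :=
  Measure.map_conv_addMonoidHom _ (continuous_tauHom c).measurable

/-! ### The case `a = -1` -/

/-- Two linearly dependent Hermitian functions have a real coefficient of proportionality, of
modulus at most `1` in one of the two directions. -/
theorem exists_real_proportional {h₁ h₂ : ℝ → ℂ} (hc₁ : ∀ x, h₁ (-x) = star (h₁ x))
    (hc₂ : ∀ x, h₂ (-x) = star (h₂ x)) (H : ∀ x y, h₁ x * h₂ y = h₁ y * h₂ x) :
    (∃ κ : ℝ, |κ| ≤ 1 ∧ ∀ s, h₂ s = κ * h₁ s) ∨ ∃ κ : ℝ, |κ| ≤ 1 ∧ ∀ s, h₁ s = κ * h₂ s := by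
  by_cases h0 : ∀ y, h₂ y = 0
  · exact Or.inl ⟨0, by simp, by simpa using h0⟩
  push Not at h0
  obtain ⟨y, hy⟩ := h0
  obtain ⟨k, hk⟩ : ∃ k, k = h₁ y / h₂ y := ⟨_, rfl⟩
  have hk1 : ∀ x, h₁ x = k * h₂ x := fun x => by
    rw [hk]
    field_simp
    linear_combination H x y
  have hreal : star k = k := by
    have h1 := hk1 (-y)
    rw [hc₁, hc₂, hk1 y, star_mul'] at h1
    exact mul_right_cancel₀ (star_ne_zero.2 hy) h1
  obtain ⟨r, rfl⟩ := Complex.conj_eq_iff_real.1 hreal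
  rcases le_or_gt |r| 1 with hr | hr
  · exact Or.inr ⟨r, hr, hk1⟩
  · have hr0 : r ≠ 0 := by
      rintro rfl
      norm_num at hr
    refine Or.inl ⟨r⁻¹, ?_, fun s => ?_⟩
    · rw [abs_inv]
      exact inv_le_one_of_one_le₀ hr.le
    · rw [hk1 s, Complex.ofReal_inv, inv_mul_cancel_left₀ (by exact_mod_cast hr0)]

theorem HeydeEq.of_neg_one {b : ℝ} {μ₁ μ₂ : Measure RT} [IsProbabilityMeasure μ₁]
    [IsProbabilityMeasure μ₂] (H : HeydeEq (-1) b μ₁ μ₂) :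
    ∃ (x₁ x₂ : RT) (l₁ l₂ : Measure RT),
        ConcentratedOn l₁ (subF (-1) b + (subG : Set RT)) ∧
        ConcentratedOn l₂ (subF (-1) b + (subG : Set RT)) ∧
        μ₁ = l₁ ∗ Measure.dirac x₁ ∧ μ₂ = l₂ ∗ Measure.dirac x₂ ∧
        ((∃ ω₁, ConcentratedOn ω₁ (subG : Set RT) ∧ l₂ = l₁ ∗ ω₁) ∨
          (∃ ω₂, ConcentratedOn ω₂ (subG : Set RT) ∧ l₁ = l₂ ∗ ω₂)) := by
  obtain ⟨x₁, x₂, M₁, M₂, _, _, e₁, e₂, -, -, hM⟩ := H.exists_eq_map_tauHom (by norm_num)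
  refine ⟨x₁, x₂, _, _, concentratedOn_map_tauHom _ _ M₁, concentratedOn_map_tauHom _ _ M₂,
    e₁, e₂, ?_⟩
  have hM' : ∀ k x y, charFn pairRZ2 M₁ (x, k) * charFn pairRZ2 M₂ (y, k) =
      charFn pairRZ2 M₁ (y, k) * charFn pairRZ2 M₂ (x, k) := by
    intro k x y
    have := hM k ((x + y) / 2) ((x - y) / 2)
    convert this using 4 <;> ring
  have h0 : ∀ s, charFn pairRZ2 M₁ (s, 0) = charFn pairRZ2 M₂ (s, 0) := by
    intro s
    simpa [charFn_pairRZ2_zero_zero] using hM' 0 s 0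
  rcases exists_real_proportional (fun x => charFn_pairRZ2_neg M₁ x 1)
    (fun x => charFn_pairRZ2_neg M₂ x 1) (hM' 1) with ⟨κ, hκ, h⟩ | ⟨κ, hκ, h⟩
  · have := isProbabilityMeasure_twoPoint hκ
    refine Or.inl ⟨_, concentratedOn_map_twoPoint (b / (-1 - 1)) hκ, ?_⟩
    rw [← map_tauHom_conv, ← eq_conv_twoPoint hκ (fun s => (h0 s).symm) h]
  · have := isProbabilityMeasure_twoPoint hκ
    refine Or.inr ⟨_, concentratedOn_map_twoPoint (b / (-1 - 1)) hκ, ?_⟩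
    rw [← map_tauHom_conv, ← eq_conv_twoPoint hκ h0 h]

/-! ### Negative `a ≠ -1` -/

theorem charFn_map_prodMk_zero (N : Measure ℝ) (s : ℝ) (l : ZMod 2) :
    charFn pairRZ2 (N.map fun t => ((t, 0) : RZ2)) (s, l) = charFun N s := by
  rw [charFn, integral_map (by fun_prop) (continuous_pairRZ2 _).aestronglyMeasurable,
    ← charFn_pairR, charFn]
  simp [pairRZ2]

theorem isGaussianOnF_map {a b σ : ℝ} (hσ : 0 ≤ σ) (β : ℝ) :
    IsGaussianOnF a b
      (((gaussR σ β).map fun t => ((t, 0) : RZ2)).map (tauHom (b / (a - 1)))) := by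
  have h1 : IsProbabilityMeasure ((gaussR σ β).map fun t => ((t, 0) : RZ2)) :=
    Measure.isProbabilityMeasure_map (by fun_prop)
  have h2 : IsProbabilityMeasure
      (((gaussR σ β).map fun t => ((t, 0) : RZ2)).map (tauHom (b / (a - 1)))) :=
    Measure.isProbabilityMeasure_map (continuous_tauHom _).measurable.aemeasurable
  obtain ⟨c, hc⟩ : ∃ c, c = b / (a - 1) := ⟨_, rfl⟩
  refine ⟨⟨h2, (tauHom (b / (a - 1)) (β, 0)), fun y => σ * (y.1 + c * y.2) ^ 2, ?_, ?_, ?_, ?_⟩,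
    h2, ?_⟩
  · have h : Continuous fun y : ℝ × ℤ => (y.2 : ℝ) := by fun_prop
    fun_prop
  · intro y
    positivity
  · intro u v
    simp only [Prod.fst_add, Prod.snd_add, Prod.fst_sub, Prod.snd_sub]
    push_cast
    ring
  · rintro ⟨s, n⟩
    rw [charFn_map_tauHom, charFn_map_prodMk_zero, charFun_gaussR hσ, pairRT_tauHom, pairRZ2, pairR,
      zero_mul, ZMod.val_zero, pow_zero, mul_one, ← Complex.exp_add, ← hc]
    congr 1
    push_cast
    ring
  · have hF : MeasurableSet (subF a b)ᶜ := by
      have hr : subF a b = tauHom (b / (a - 1)) '' (Prod.snd ⁻¹' {0}) := by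
        ext x
        simp only [subF, tau_eq_tauHom, Set.mem_range, Set.mem_image, Set.mem_preimage,
          Set.mem_singleton_iff, Prod.exists]
        constructor
        · rintro ⟨t, rfl⟩
          exact ⟨t, 0, rfl, rfl⟩
        · rintro ⟨t, k, rfl, rfl⟩
          exact ⟨t, rfl⟩
      rw [hr]
      exact ((measurableEmbedding_tauHom _).measurableSet_image.2
        (measurable_snd (measurableSet_singleton _))).compl
    rw [(measurableEmbedding_tauHom _).map_apply, Measure.map_apply (by fun_prop)
      ((continuous_tauHom _).measurable hF)]
    convert measure_empty (μ := gaussR σ β)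
    rw [Set.eq_empty_iff_forall_notMem]
    intro t h
    exact h ⟨t, by rw [tau_eq_tauHom]⟩

theorem eq_gauss_conv_haarG {c σ β : ℝ} (hσ : 0 ≤ σ) {M : Measure RZ2} [IsProbabilityMeasure M]
    (h0 : ∀ s : ℝ, charFn pairRZ2 M (s, 0)
      = Complex.exp (-(σ : ℂ) * s ^ 2 + Complex.I * β * s))
    (h1 : ∀ s, charFn pairRZ2 M (s, 1) = 0) :
    M.map (tauHom c) = ((gaussR σ β).map fun t => ((t, 0) : RZ2)).map (tauHom c) ∗ haarG := by
  have := isProbabilityMeasure_twoPoint (κ := 0) (by simp)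
  rw [← map_twoPoint_zero c, ← map_tauHom_conv]
  congr 1
  refine eq_conv_twoPoint (by simp) (fun s => ?_) fun s => by simp [h1]
  rw [h0, charFn_map_prodMk_zero, charFun_gaussR hσ]

/-- A product of two analytic functions with dilated arguments vanishes identically only if one of
the functions does. -/
theorem eq_zero_or_eq_zero_of_dilation_mul {A B : ℝ → ℂ} (hA : AnalyticOnNhd ℝ A Set.univ)
    (hB : AnalyticOnNhd ℝ B Set.univ) {p q : ℝ} (hp : p ≠ 0) (hq : q ≠ 0)
    (h : ∀ u, A (p * u) * B (q * u) = 0) : (∀ x, A x = 0) ∨ ∀ x, B x = 0 := by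
  have hd : ∀ (C : ℝ → ℂ) (r : ℝ), AnalyticOnNhd ℝ C Set.univ →
      AnalyticOnNhd ℝ (fun u => C (r * u)) Set.univ := fun C r hC x _ =>
    (hC (r * x) (Set.mem_univ _)).comp_of_eq (analyticAt_const.mul analyticAt_id) rfl
  refine ((hd A p hA).eq_zero_or_eq_zero_of_mul_eq_zero (hd B q hB) (fun u _ => h u)
    isPreconnected_univ).imp (fun h x => ?_) fun h x => ?_
  · simpa [mul_div_cancel₀ _ hp] using h (x / p) (Set.mem_univ _)
  · simpa [mul_div_cancel₀ _ hq] using h (x / q) (Set.mem_univ _)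

theorem HeydeEq.of_neg {a b : ℝ} {μ₁ μ₂ : Measure RT} [IsProbabilityMeasure μ₁]
    [IsProbabilityMeasure μ₂] (H : HeydeEq a b μ₁ μ₂) (ha : a < 0) (ha' : a ≠ -1) :
    (∃ (x₁ x₂ : RT) (M₁ M₂ : Measure RZ2),
        ClassLambda M₁ ∧ ClassLambda M₂ ∧
        μ₁ = M₁.map (tau a b) ∗ Measure.dirac x₁ ∧
        μ₂ = M₂.map (tau a b) ∗ Measure.dirac x₂ ∧
        ((∃ γ₁, IsGaussianOnF a b γ₁ ∧ μ₁ = (γ₁ ∗ haarG) ∗ Measure.dirac x₁) ∨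
          (∃ γ₂, IsGaussianOnF a b γ₂ ∧ μ₂ = (γ₂ ∗ haarG) ∗ Measure.dirac x₂))) ∨
    (∃ (x₁ x₂ : RT) (M₁ M₂ : Measure RZ2),
        ClassTheta M₁ ∧ ClassTheta M₂ ∧
        μ₁ = M₁.map (tau a b) ∗ Measure.dirac x₁ ∧
        μ₂ = M₂.map (tau a b) ∗ Measure.dirac x₂ ∧
        (∀ y, charFn pairRT μ₁ y ≠ 0) ∧ (∀ y, charFn pairRT μ₂ y ≠ 0)) := by
  have ha1 : a ≠ 1 := by linarith
  have ha1' : 1 + a ≠ 0 := fun h => ha' (by linarith)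
  obtain ⟨x₁, x₂, M₁, M₂, _, _, e₁, e₂, -, -, hM⟩ := H.exists_eq_map_tauHom ha1
  rw [tau_eq_tauHom]
  have hb₁ : ∀ y, ‖charFn pairRZ2 M₁ y‖ ≤ 1 := norm_charFn_le_one norm_pairRZ2 M₁
  have hb₂ : ∀ y, ‖charFn pairRZ2 M₂ y‖ ≤ 1 := norm_charFn_le_one norm_pairRZ2 M₂
  have hheyde := fun (k : ZMod 2) (h₁ : charFn pairRZ2 M₁ (0, k) ≠ 0)
      (h₂ : charFn pairRZ2 M₂ (0, k) ≠ 0) =>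
    heyde_gaussian_form ha.ne ha1 ha' (continuous_charFn_pairRZ2 M₁ k)
      (continuous_charFn_pairRZ2 M₂ k) h₁ h₂ (fun x => charFn_pairRZ2_neg M₁ x k)
      (fun x => charFn_pairRZ2_neg M₂ x k) (fun x => hb₁ _) (fun x => hb₂ _) (hM k)
  obtain ⟨⟨σ₁, β₁, hσ₁, h₁⟩, σ₂, β₂, hσ₂, h₂⟩ := hheyde 0
    (by simp [charFn_pairRZ2_zero_zero]) (by simp [charFn_pairRZ2_zero_zero])
  simp only [charFn_pairRZ2_zero_zero, one_mul] at h₁ h₂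
  -- If an odd component vanishes identically, the corresponding distribution has a factor `m_G`.
  by_cases hz₁ : ∀ s, charFn pairRZ2 M₁ (s, 1) = 0
  · refine Or.inl ⟨x₁, x₂, M₁, M₂, classLambda_of_charFn hσ₁ h₁, classLambda_of_charFn hσ₂ h₂,
      e₁, e₂, Or.inl ⟨_, isGaussianOnF_map hσ₁ β₁, ?_⟩⟩
    rw [← eq_gauss_conv_haarG hσ₁ h₁ hz₁, ← e₁]
  by_cases hz₂ : ∀ s, charFn pairRZ2 M₂ (s, 1) = 0
  · refine Or.inl ⟨x₁, x₂, M₁, M₂, classLambda_of_charFn hσ₁ h₁, classLambda_of_charFn hσ₂ h₂,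
      e₁, e₂, Or.inr ⟨_, isGaussianOnF_map hσ₂ β₂, ?_⟩⟩
    rw [← eq_gauss_conv_haarG hσ₂ h₂ hz₂, ← e₂]
  have hprod : ∀ p q : ℝ, p ≠ 0 → q ≠ 0 →
      ¬ ∀ u, charFn pairRZ2 M₁ (p * u, 1) * charFn pairRZ2 M₂ (q * u, 1) = 0 :=
    fun p q hp hq h => (eq_zero_or_eq_zero_of_dilation_mul (analyticOnNhd_charFn_one hσ₁ h₁)
      (analyticOnNhd_charFn_one hσ₂ h₂) hp hq h).elim hz₁ hz₂
  -- A zero of one odd component at the origin would make a product of dilated odd components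
  -- vanish identically.
  have hne₁ : charFn pairRZ2 M₁ (0, 1) ≠ 0 := by
    intro h
    refine hprod 2 (1 + a) two_ne_zero ha1' fun u => ?_
    have := hM 1 u u
    rwa [sub_self, h, zero_mul, ← two_mul, ← one_add_mul] at this
  have hne₂ : charFn pairRZ2 M₂ (0, 1) ≠ 0 := by
    intro h
    refine hprod (1 + a) (2 * a) ha1' (mul_ne_zero two_ne_zero ha.ne) fun u => ?_
    have := hM 1 (a * u) u
    rwa [sub_self, h, mul_zero, ← two_mul, ← mul_assoc, add_comm, ← one_add_mul] at this
  obtain ⟨⟨σ₁', β₁', hσ₁', h₁'⟩, σ₂', β₂', hσ₂', h₂'⟩ := hheyde 1 hne₁ hne₂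
  have hreal : ∀ (M : Measure RZ2) [IsFiniteMeasure M], charFn pairRZ2 M (0, 1) ≠ 0 →
      ∃ κ : ℝ, κ ≠ 0 ∧ charFn pairRZ2 M (0, 1) = κ := by
    intro M _ hne
    have h := charFn_pairRZ2_neg M 0 1
    rw [neg_zero] at h
    obtain ⟨κ, hκ⟩ := Complex.conj_eq_iff_real.1 h.symm
    refine ⟨κ, ?_, hκ⟩
    rintro rfl
    exact hne (by simpa using hκ)
  obtain ⟨κ₁, hκ₁, hκ₁'⟩ := hreal M₁ hne₁
  obtain ⟨κ₂, hκ₂, hκ₂'⟩ := hreal M₂ hne₂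
  refine Or.inr ⟨x₁, x₂, M₁, M₂, classTheta_of_charFn hσ₁ hσ₁' hκ₁ h₁ (hκ₁' ▸ h₁'),
    classTheta_of_charFn hσ₂ hσ₂' hκ₂ h₂ (hκ₂' ▸ h₂'), e₁, e₂, ?_, ?_⟩
  · rw [e₁]
    refine charFn_map_tauHom_conv_dirac_ne_zero (fun s => ?_) (fun s => ?_) x₁
    · rw [h₁]; exact Complex.exp_ne_zero _
    · rw [h₁']; exact mul_ne_zero hne₁ (Complex.exp_ne_zero _)
  · rw [e₂]
    refine charFn_map_tauHom_conv_dirac_ne_zero (fun s => ?_) (fun s => ?_) x₂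
    · rw [h₂]; exact Complex.exp_ne_zero _
    · rw [h₂']; exact mul_ne_zero hne₂ (Complex.exp_ne_zero _)

end HeydeRT


theorem theorem3p1 {Ω : Type*} [MeasurableSpace Ω] (P : Measure Ω) [IsProbabilityMeasure P]
    (a b : ℝ) (α : HeydeRT.RT ≃ₜ+ HeydeRT.RT) (hα : ∀ x, α x = HeydeRT.matMap a b x)
    (ξ₁ ξ₂ : Ω → HeydeRT.RT) (hξ₁ : Measurable ξ₁) (hξ₂ : Measurable ξ₂)
    (hind : IndepFun ξ₁ ξ₂ P)
    (μ₁ μ₂ : Measure HeydeRT.RT) (hμ₁ : P.map ξ₁ = μ₁) (hμ₂ : P.map ξ₂ = μ₂)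
    (hsymm : HeydeRT.CondSymmetric P (fun ω => ξ₁ ω + α (ξ₂ ω)) (fun ω => ξ₁ ω + ξ₂ ω)) :
    (a < 0 → a ≠ -1 →
      (∃ (x₁ x₂ : HeydeRT.RT) (M₁ M₂ : Measure HeydeRT.RZ2),
          HeydeRT.ClassLambda M₁ ∧ HeydeRT.ClassLambda M₂ ∧
          μ₁ = M₁.map (HeydeRT.tau a b) ∗ Measure.dirac x₁ ∧
          μ₂ = M₂.map (HeydeRT.tau a b) ∗ Measure.dirac x₂ ∧
          ((∃ γ₁, HeydeRT.IsGaussianOnF a b γ₁ ∧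
              μ₁ = (γ₁ ∗ HeydeRT.haarG) ∗ Measure.dirac x₁) ∨
            (∃ γ₂, HeydeRT.IsGaussianOnF a b γ₂ ∧
              μ₂ = (γ₂ ∗ HeydeRT.haarG) ∗ Measure.dirac x₂))) ∨
      (∃ (x₁ x₂ : HeydeRT.RT) (M₁ M₂ : Measure HeydeRT.RZ2),
          HeydeRT.ClassTheta M₁ ∧ HeydeRT.ClassTheta M₂ ∧
          μ₁ = M₁.map (HeydeRT.tau a b) ∗ Measure.dirac x₁ ∧
          μ₂ = M₂.map (HeydeRT.tau a b) ∗ Measure.dirac x₂ ∧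
          (∀ y, HeydeRT.charFn HeydeRT.pairRT μ₁ y ≠ 0) ∧
          (∀ y, HeydeRT.charFn HeydeRT.pairRT μ₂ y ≠ 0))) ∧
    (a = -1 →
      ∃ (x₁ x₂ : HeydeRT.RT) (l₁ l₂ : Measure HeydeRT.RT),
        HeydeRT.ConcentratedOn l₁ (HeydeRT.subF a b + (HeydeRT.subG : Set HeydeRT.RT)) ∧
        HeydeRT.ConcentratedOn l₂ (HeydeRT.subF a b + (HeydeRT.subG : Set HeydeRT.RT)) ∧
        μ₁ = l₁ ∗ Measure.dirac x₁ ∧ μ₂ = l₂ ∗ Measure.dirac x₂ ∧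
        ((∃ ω₁, HeydeRT.ConcentratedOn ω₁ (HeydeRT.subG : Set HeydeRT.RT) ∧ l₂ = l₁ ∗ ω₁) ∨
          (∃ ω₂, HeydeRT.ConcentratedOn ω₂ (HeydeRT.subG : Set HeydeRT.RT) ∧ l₁ = l₂ ∗ ω₂))) ∧
    (0 < a →
      ∃ x₁ x₂ : HeydeRT.RT,
        HeydeRT.ConcentratedOn (μ₁ ∗ Measure.dirac x₁) (HeydeRT.subG : Set HeydeRT.RT) ∧
        HeydeRT.ConcentratedOn (μ₂ ∗ Measure.dirac x₂) (HeydeRT.subG : Set HeydeRT.RT)) := by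
  have hp₁ : IsProbabilityMeasure μ₁ := hμ₁ ▸ Measure.isProbabilityMeasure_map hξ₁.aemeasurable
  have hp₂ : IsProbabilityMeasure μ₂ := hμ₂ ▸ Measure.isProbabilityMeasure_map hξ₂.aemeasurable
  have H : HeydeRT.HeydeEq a b μ₁ μ₂ := by
    subst hμ₁ hμ₂
    exact HeydeRT.heyde_functional_equation hα α.continuous.measurable hξ₁ hξ₂ hind hsymm
  refine ⟨H.of_neg, ?_, H.concentratedOn_subG⟩
  rintro rfl
  exact H.of_neg_one
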